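/- All manifolds, metrics, vector fields and functions are smooth, and all manifolds have dimension at least $2$. A vector field $v$ on a pseudo-Riemannian manifold $(M,g)$, with Levi-Civita connection $\nabla$, is called conformal if $2\nabla v=A+\phi\,\mathrm{Id}$ for a field $A$ of endomorphisms of the tangent spaces, skew-adjoint with respect to $g$ at every point, and a function $\phi:M\to\mathbb R$; then $\phi$ and $A$ are determined by $v$. For an inner product $\eta$ (nondegenerate, of any signature) on a finite-dimensional real vector space $\mathcal T$, let $[\eta]=\{c\,\eta : c>0\}$. If $v$ is conformal and $v_x=0$, the quintuple associated with $v$ and $x$ is $$(\mathcal T,[\eta],B,\lambda,\delta)=\bigl(T_xM,\ [g_x],\ A_x,\ \phi(x),\ d\phi_x|_{\mathrm{Ker}(B+\lambda)}\bigr),\qquad \mathrm{Ker}(B+\lambda)=\mathrm{Ker}\,\nabla v_x .$$ Two quintuples $(\mathcal T,[\eta],B,\lambda,\delta)$ and $(\mathcal T',[\eta'],B',\lambda',\delta')$ are algebraically equivalent if $\lambda'=\lambda$ and some linear isomorphism $\mathcal T\to\mathcal T'$ sends $[\eta]$ to $[\eta']$, $B$ to $B'$, and $\delta$ to $\delta'$.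 Let $v$ and $w$ be conformal vector fields on pseudo-Riemannian manifolds $(M,g)$ and $(N,h)$, with $v_x=0$ and $w_y=0$ for points $x\in M$ and $y\in N$. The $2$-jet of $v$ at $x$ is called conformally equivalent to the $2$-jet of $w$ at $y$ if there is a diffeomorphism $F$ from a neighborhood $U$ of $x$ in $M$ onto a neighborhood of $y$ in $N$, with $F(x)=y$, that sends the former $2$-jet to the latter, and a function $\tau:U\to\mathbb R$ such that $F^*h$ and $e^\tau g$ have the same $1$-jet at $x$. **Lemma.** (i) The $2$-jets of $v$ at $x$ and of $w$ at $y$ are conformally equivalent if and only if the quintuple associated with $v$ and $x$ is algebraically equivalent to the quintuple associated with $w$ and $y$. (ii) The same holds if nonzero factors of either sign are allowed on both sides, that is, if $[\eta]$ is replaced by the set $\{c\,\eta : c\ne 0\}$, and "$F^*h$ and $e^\tau g$ have the same $1$-jet at $x$" is replaced by "$F^*h$ has at $x$ the same $1$-jet as $e^\tau g$ or as $-e^\tau g$". -/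

import Mathlib

open Bundle Manifold VectorField
open scoped ContDiff

noncomputable section

namespace ConformalJets

section Geometry

variable {E : Type*} [NormedAddCommGroup E] [NormedSpace ℝ E] [FiniteDimensional ℝ E]
  {M : Type*} [TopologicalSpace M] [ChartedSpace E M] [IsManifold 𝓘(ℝ, E) ∞ M]

variable (E M) in
/-- A smooth pseudo-Riemannian metric on `M`: a smooth section of the bundle of bilinear forms on
the tangent bundle, symmetric and nondegenerate at every point, of any signature. -/
structure PseudoRiemannianMetric where
  val (p : M) : TangentSpace 𝓘(ℝ, E) p →L[ℝ] TangentSpace 𝓘(ℝ, E) p →L[ℝ] ℝ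
  symm (p : M) (u w : TangentSpace 𝓘(ℝ, E) p) : val p u w = val p w u
  nondegenerate (p : M) (u : TangentSpace 𝓘(ℝ, E) p) (hu : ∀ w, val p u w = 0) : u = 0
  smooth : ContMDiff 𝓘(ℝ, E) (𝓘(ℝ, E).prod 𝓘(ℝ, E →L[ℝ] E →L[ℝ] ℝ)) ∞
    (fun p ↦ TotalSpace.mk' (E →L[ℝ] E →L[ℝ] ℝ)
      (E := fun p : M ↦ TangentSpace 𝓘(ℝ, E) p →L[ℝ] TangentSpace 𝓘(ℝ, E) p →L[ℝ] ℝ) p (val p))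

namespace PseudoRiemannianMetric

variable (g : PseudoRiemannianMetric E M)

set_option synthInstance.maxHeartbeats 200000 in
/-- The metric `-g`. -/
def neg : PseudoRiemannianMetric E M where
  val := -g.val
  symm p u w := by simp [g.symm p u w]
  nondegenerate p u hu := g.nondegenerate p u fun w ↦ by simpa using hu w
  smooth := g.smooth.neg_section

/-- The metric at a point as a bilinear form on the tangent space. -/
def form (p : M) : LinearMap.BilinForm ℝ (TangentSpace 𝓘(ℝ, E) p) :=
  LinearMap.mk₂ ℝ (fun u w ↦ g.val p u w) (by simp) (by simp) (by simp) (by simp)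

lemma form_apply (p : M) (u w : TangentSpace 𝓘(ℝ, E) p) : g.form p u w = g.val p u w := rfl

lemma form_symm (p : M) (u w : TangentSpace 𝓘(ℝ, E) p) : g.form p u w = g.form p w u :=
  g.symm p u w

lemma form_nondegenerate (p : M) : (g.form p).Nondegenerate :=
  ⟨fun u hu ↦ g.nondegenerate p u hu,
    fun u hu ↦ g.nondegenerate p u fun w ↦ (g.symm p u w).trans (hu w)⟩

lemma mdifferentiableAt_val {X Y : Π p : M, TangentSpace 𝓘(ℝ, E) p} {p : M}
    (hX : MDiffAt (T% X) p) (hY : MDiffAt (T% Y) p) :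
    MDifferentiableAt 𝓘(ℝ, E) 𝓘(ℝ, ℝ) (fun q ↦ g.val q (X q) (Y q)) p := by
  have h : MDifferentiableAt 𝓘(ℝ, E) (𝓘(ℝ, E).prod 𝓘(ℝ, ℝ))
      (fun q ↦ TotalSpace.mk' ℝ (E := Bundle.Trivial M ℝ) q (g.val q (X q) (Y q))) p :=
    MDifferentiableAt.clm_bundle_apply₂ (F₁ := E) (F₂ := E)
      (g.smooth.mdifferentiableAt (by simp)) hX hY
  rw [mdifferentiableAt_totalSpace] at h
  exact h.2

/-- The right-hand side of the Koszul formula for `2 g(∇_X v, Y)`. -/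
def koszul (v X Y : Π p : M, TangentSpace 𝓘(ℝ, E) p) (p : M) : ℝ :=
  mvfderiv 𝓘(ℝ, E) (fun q ↦ g.val q (v q) (Y q)) p (X p)
    + mvfderiv 𝓘(ℝ, E) (fun q ↦ g.val q (X q) (Y q)) p (v p)
    - mvfderiv 𝓘(ℝ, E) (fun q ↦ g.val q (X q) (v q)) p (Y p)
    + g.val p (mlieBracket 𝓘(ℝ, E) X v p) (Y p)
    - g.val p (mlieBracket 𝓘(ℝ, E) X Y p) (v p)
    - g.val p (mlieBracket 𝓘(ℝ, E) v Y p) (X p)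

lemma koszul_tensorial_left {v : Π p : M, TangentSpace 𝓘(ℝ, E) p} {p : M}
    (hv : MDiffAt (T% v) p) (Y : Π p : M, TangentSpace 𝓘(ℝ, E) p) (hY : MDiffAt (T% Y) p) :
    TensorialAt 𝓘(ℝ, E) E (fun X ↦ g.koszul v X Y p) p where
  smul {f X} hf hX := by
    have h1 := mvfderiv_fun_mul hf (g.mdifferentiableAt_val hX hY)
    have h2 := mvfderiv_fun_mul hf (g.mdifferentiableAt_val hX hv)
    simp [koszul, h1, h2, mlieBracket_smul_left hf hX]
    ring
  add {X X'} hX hX' := by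
    have h1 := mvfderiv_fun_add (g.mdifferentiableAt_val hX hY) (g.mdifferentiableAt_val hX' hY)
    have h2 := mvfderiv_fun_add (g.mdifferentiableAt_val hX hv) (g.mdifferentiableAt_val hX' hv)
    simp [koszul, h1, h2, mlieBracket_add_left hX hX']
    ring

lemma koszul_tensorial_right {v : Π p : M, TangentSpace 𝓘(ℝ, E) p} {p : M}
    (hv : MDiffAt (T% v) p) (X : Π p : M, TangentSpace 𝓘(ℝ, E) p) (hX : MDiffAt (T% X) p) :
    TensorialAt 𝓘(ℝ, E) E (fun Y ↦ g.koszul v X Y p) p where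
  smul {f Y} hf hY := by
    have h1 := mvfderiv_fun_mul hf (g.mdifferentiableAt_val hv hY)
    have h2 := mvfderiv_fun_mul hf (g.mdifferentiableAt_val hX hY)
    simp [koszul, h1, h2, mlieBracket_smul_right hf hY, g.symm p (Y p)]
    ring
  add {Y Y'} hY hY' := by
    have h1 := mvfderiv_fun_add (g.mdifferentiableAt_val hv hY) (g.mdifferentiableAt_val hv hY')
    have h2 := mvfderiv_fun_add (g.mdifferentiableAt_val hX hY) (g.mdifferentiableAt_val hX hY')
    simp [koszul, h1, h2, mlieBracket_add_right hY hY']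
    ring

/-- The bilinear form `(u, w) ↦ g(∇_u v, w)` at `p`, for the Levi-Civita connection `∇`. -/
def nablaForm (v : Π p : M, TangentSpace 𝓘(ℝ, E) p)
    (hv : ContMDiff 𝓘(ℝ, E) 𝓘(ℝ, E).tangent ∞ (T% v)) (p : M) :
    TangentSpace 𝓘(ℝ, E) p →L[ℝ] TangentSpace 𝓘(ℝ, E) p →L[ℝ] ℝ :=
  (1 / 2 : ℝ) • TensorialAt.mkHom₂ (fun X Y ↦ g.koszul v X Y p) p
    (fun Y hY ↦ g.koszul_tensorial_left (hv.mdifferentiableAt (by simp)) Y hY)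
    (fun X hX ↦ g.koszul_tensorial_right (hv.mdifferentiableAt (by simp)) X hX)

lemma nablaForm_apply {v : Π p : M, TangentSpace 𝓘(ℝ, E) p}
    (hv : ContMDiff 𝓘(ℝ, E) 𝓘(ℝ, E).tangent ∞ (T% v)) {p : M}
    {X Y : Π p : M, TangentSpace 𝓘(ℝ, E) p} (hX : MDiffAt (T% X) p) (hY : MDiffAt (T% Y) p) :
    g.nablaForm v hv p (X p) (Y p) = (1 / 2 : ℝ) * g.koszul v X Y p := by
  simp only [nablaForm, smul_apply, smul_eq_mul]
  rw [TensorialAt.mkHom₂_apply _ _ hX hY]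

instance (p : M) : FiniteDimensional ℝ (TangentSpace 𝓘(ℝ, E) p) :=
  inferInstanceAs (FiniteDimensional ℝ E)

/-- The Levi-Civita covariant derivative of a smooth vector field `v`, as the endomorphism
`u ↦ ∇_u v` of the tangent space at `p`. -/
def nabla (v : Π p : M, TangentSpace 𝓘(ℝ, E) p)
    (hv : ContMDiff 𝓘(ℝ, E) 𝓘(ℝ, E).tangent ∞ (T% v)) (p : M) :
    TangentSpace 𝓘(ℝ, E) p →ₗ[ℝ] TangentSpace 𝓘(ℝ, E) p where
  toFun u := ((g.form p).toDual (g.form_nondegenerate p)).symm (g.nablaForm v hv p u).toLinearMap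
  map_add' u u' := by rw [← map_add, map_add]; rfl
  map_smul' c u := by rw [RingHom.id_apply, ← map_smul, map_smul]; rfl

lemma val_nabla {v : Π p : M, TangentSpace 𝓘(ℝ, E) p}
    (hv : ContMDiff 𝓘(ℝ, E) 𝓘(ℝ, E).tangent ∞ (T% v)) (p : M) (u w : TangentSpace 𝓘(ℝ, E) p) :
    g.val p (g.nabla v hv p u) w = g.nablaForm v hv p u w :=
  LinearMap.BilinForm.apply_toDual_symm_apply (hB := g.form_nondegenerate p)
    (g.nablaForm v hv p u).toLinearMap w

end PseudoRiemannianMetric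

/-- A conformal vector field `v` on `(M, g)`: a smooth vector field with
`2∇v = A + φ Id`, where `A` is an endomorphism of the tangent bundle that is skew-adjoint at every
point and `φ` is a smooth function (so that the Lie derivative of `g` along `v` equals `φ g`).
In positive dimensions `φ` and `A` are determined by `v`, and `A = 2∇v - φ Id` is smooth. -/
structure ConformalVectorField (g : PseudoRiemannianMetric E M) where
  toFun (p : M) : TangentSpace 𝓘(ℝ, E) p
  smooth : ContMDiff 𝓘(ℝ, E) 𝓘(ℝ, E).tangent ∞ (T% toFun)
  A (p : M) : TangentSpace 𝓘(ℝ, E) p →ₗ[ℝ] TangentSpace 𝓘(ℝ, E) p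
  φ : M → ℝ
  skew (p : M) (u w : TangentSpace 𝓘(ℝ, E) p) : g.val p (A p u) w = -g.val p u (A p w)
  smooth_φ : ContMDiff 𝓘(ℝ, E) 𝓘(ℝ, ℝ) ∞ φ
  two_nabla (p : M) : (2 : ℝ) • g.nabla toFun smooth p = A p + φ p • LinearMap.id

end Geometry

section Algebra

/-- The homothety class of a bilinear form: all its multiples by scalars from `C`. -/
def homothetyClass (C : Set ℝ) {T : Type*} [AddCommGroup T] [Module ℝ T]
    (η : LinearMap.BilinForm ℝ T) : Set (LinearMap.BilinForm ℝ T) :=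
  {β | ∃ c ∈ C, β = c • η}

/-- The data `(T, η, B, λ, δ)`: a pseudo-Euclidean vector space `(T, η)`, a skew-adjoint
endomorphism `B`, a real number `λ` and a linear functional `δ` on `Ker (B + λ)`. The inner
product `η` is the representative of a homothety class; only its class enters below. -/
structure Quintuple (T : Type*) [AddCommGroup T] [Module ℝ T] where
  η : LinearMap.BilinForm ℝ T
  symm (u w : T) : η u w = η w u
  nondegenerate : η.Nondegenerate
  B : T →ₗ[ℝ] T
  skew (u w : T) : η (B u) w = -η u (B w)
  lam : ℝ
  δ : (LinearMap.ker (B + lam • (LinearMap.id : T →ₗ[ℝ] T))) →ₗ[ℝ] ℝ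

/-- Algebraic equivalence of quintuples, the homothety classes being formed with factors in `C`:
`λ' = λ`, and some linear isomorphism `L` sends `[η]` to `[η']`, `B` to `B'` and `δ` to `δ'`
(such an `L` maps `Ker (B + λ)` onto `Ker (B' + λ')`). -/
def Quintuple.AlgebraicallyEquivalent (C : Set ℝ) {T T' : Type*} [AddCommGroup T] [Module ℝ T]
    [AddCommGroup T'] [Module ℝ T'] (Q : Quintuple T) (Q' : Quintuple T') : Prop :=
  Q'.lam = Q.lam ∧ ∃ L : T ≃ₗ[ℝ] T',
    (fun β : LinearMap.BilinForm ℝ T ↦ β.compl₁₂ L.symm.toLinearMap L.symm.toLinearMap) ''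
      homothetyClass C Q.η = homothetyClass C Q'.η ∧
    (∀ u, L (Q.B u) = Q'.B (L u)) ∧
    ∀ (u : T) (hu : u ∈ LinearMap.ker (Q.B + Q.lam • (LinearMap.id : T →ₗ[ℝ] T)))
      (hu' : L u ∈ LinearMap.ker (Q'.B + Q'.lam • (LinearMap.id : T' →ₗ[ℝ] T'))),
      Q'.δ ⟨L u, hu'⟩ = Q.δ ⟨u, hu⟩

end Algebra

section Quintuples

variable {E : Type*} [NormedAddCommGroup E] [NormedSpace ℝ E] [FiniteDimensional ℝ E]
  {M : Type*} [TopologicalSpace M] [ChartedSpace E M] [IsManifold 𝓘(ℝ, E) ∞ M]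

/-- The quintuple `(T_x M, [g_x], A_x, φ(x), δ)` associated with a conformal vector field `v` and
a point `x` (meant for `v x = 0`), where `2∇v = A + φ Id` and `δ` is the restriction of `dφ_x` to
`Ker (A_x + φ(x)) = Ker ∇v_x`. -/
def ConformalVectorField.quintuple {g : PseudoRiemannianMetric E M}
    (v : ConformalVectorField g) (x : M) : Quintuple (TangentSpace 𝓘(ℝ, E) x) where
  η := g.form x
  symm := g.form_symm x
  nondegenerate := g.form_nondegenerate x
  B := v.A x
  skew := v.skew x
  lam := v.φ x
  δ := (mvfderiv 𝓘(ℝ, E) v.φ x).toLinearMap.domRestrict _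

end Quintuples

section Jets

variable {E : Type*} [NormedAddCommGroup E] [NormedSpace ℝ E]
  {M : Type*} [TopologicalSpace M] [ChartedSpace E M]

/-- The local representative of a section `s` of a vector bundle `V` with fibre `F`, in the chart
of `M` and the trivialization of `V` at `x`. -/
def localRep (F : Type*) [NormedAddCommGroup F] [NormedSpace ℝ F] {V : M → Type*}
    [TopologicalSpace (TotalSpace F V)] [∀ p, TopologicalSpace (V p)] [FiberBundle F V]
    (s : Π p, V p) (x : M) (z : E) : F :=
  (trivializationAt F V x ⟨(extChartAt 𝓘(ℝ, E) x).symm z, s _⟩).2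

/-- Two sections of a vector bundle, smooth near `x`, have the same `k`-jet at `x`: in the chart
and trivialization at `x`, their values and partial derivatives up to order `k` agree at `x`. -/
def SameJet (k : ℕ) (F : Type*) [NormedAddCommGroup F] [NormedSpace ℝ F] {V : M → Type*}
    [TopologicalSpace (TotalSpace F V)] [∀ p, TopologicalSpace (V p)] [FiberBundle F V]
    (s t : Π p, V p) (x : M) : Prop :=
  ∀ j ≤ k, iteratedFDeriv ℝ j (localRep (E := E) F s x) (extChartAt 𝓘(ℝ, E) x x) =
    iteratedFDeriv ℝ j (localRep (E := E) F t x) (extChartAt 𝓘(ℝ, E) x x)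

variable [IsManifold 𝓘(ℝ, E) ∞ M]
  {E' : Type*} [NormedAddCommGroup E'] [NormedSpace ℝ E']
  {N : Type*} [TopologicalSpace N] [ChartedSpace E' N] [IsManifold 𝓘(ℝ, E') ∞ N]

/-- The pullback `F^*h` of a family of bilinear forms on the tangent spaces. -/
def pullbackForm (F : M → N)
    (h : Π q : N, TangentSpace 𝓘(ℝ, E') q →L[ℝ] TangentSpace 𝓘(ℝ, E') q →L[ℝ] ℝ) (p : M) :
    TangentSpace 𝓘(ℝ, E) p →L[ℝ] TangentSpace 𝓘(ℝ, E) p →L[ℝ] ℝ :=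
  (ContinuousLinearMap.precomp ℝ (mfderiv 𝓘(ℝ, E) 𝓘(ℝ, E') F p)).comp
    ((h (F p)).comp (mfderiv 𝓘(ℝ, E) 𝓘(ℝ, E') F p))

lemma pullbackForm_apply (F : M → N)
    (h : Π q : N, TangentSpace 𝓘(ℝ, E') q →L[ℝ] TangentSpace 𝓘(ℝ, E') q →L[ℝ] ℝ) (p : M)
    (u w : TangentSpace 𝓘(ℝ, E) p) :
    pullbackForm F h p u w =
      h (F p) (mfderiv 𝓘(ℝ, E) 𝓘(ℝ, E') F p u) (mfderiv 𝓘(ℝ, E) 𝓘(ℝ, E') F p w) := rfl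

/-- Conformal equivalence of the `2`-jet of `v` at `x` with the `2`-jet of `w` at `y`: some
diffeomorphism `F` between open neighbourhoods `U` of `x` and `V` of `y`, with `F x = y`, is such
that `F_* v` (the pullback of `v` under the inverse of `F`) and `w` have the same `2`-jet at `y`,
while, for some smooth `τ : U → ℝ`, the metrics `F^*h` and `e^τ g` have the same `1`-jet at `x`. -/
def TwoJetsConformallyEquivalent
    (g : PseudoRiemannianMetric E M) (v : Π p : M, TangentSpace 𝓘(ℝ, E) p) (x : M)
    (h : PseudoRiemannianMetric E' N) (w : Π q : N, TangentSpace 𝓘(ℝ, E') q) (y : N) : Prop :=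
  ∃ (F : OpenPartialHomeomorph M N) (τ : M → ℝ),
    x ∈ F.source ∧ F x = y ∧
    ContMDiffOn 𝓘(ℝ, E) 𝓘(ℝ, E') ∞ F F.source ∧
    ContMDiffOn 𝓘(ℝ, E') 𝓘(ℝ, E) ∞ F.symm F.target ∧
    ContMDiffOn 𝓘(ℝ, E) 𝓘(ℝ, ℝ) ∞ τ F.source ∧
    SameJet (E := E') 2 E' (mpullback 𝓘(ℝ, E') 𝓘(ℝ, E) F.symm v) w y ∧
    SameJet (E := E) 1 (E →L[ℝ] E →L[ℝ] ℝ)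
      (V := fun p : M ↦ TangentSpace 𝓘(ℝ, E) p →L[ℝ] TangentSpace 𝓘(ℝ, E) p →L[ℝ] ℝ)
      (pullbackForm F h.val) (fun p ↦ Real.exp (τ p) • g.val p) x

end Jets

end ConformalJets

end

/-! In charts at the two points everything is finite-dimensional algebra. At a zero of `v` only
these data count: the 1-jet of the metric, the derivatives `D` and `Q` of `v` of orders one and two,
and the 1-jet `(λ, dφ)` of its factor. They are tied together by the equation `L_v g = φ g` and its
first derivative (`ConformalJet`). As `v` vanishes at the point, `D = ∇v_x`, so `2D = B + λ` and
`Ker (B + λ) = Ker D`. A candidate diffeomorphism counts only through its first two derivatives `L`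
and `R`, and `e^τ` through its value `c` and `α = dτ`.

Suppose that `L`, `R`, `c`, `α` match the metric 1-jets and that `L` intertwines `D` with `D'`. The
second-order defect `T(z, u)` of the vector jets, paired with `L w` and symmetrized in `u, w`, then
equals `c (dφ + α ∘ D - dφ' ∘ L)(z) g(u, w)`; this is `form_quad_mismatch`. The bracket compares the
differentials of the factors of the two fields, since replacing `g` by `e^τ g` adds `dτ(v)` to `φ`.

If the vector jets match, the defect is zero, and evaluating on `Ker D`, where `α` disappears, gives
equality of the functionals `δ`. Conversely, if they agree on `Ker D`, some `α` makes the bracket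
vanish (`exists_comp_eq_of_ker_le`). For this `α` the metric condition is solved for `R` as in
Koszul's formula (`exists_koszul_solution`). The defect is then symmetric in its first two arguments
and skew in the last two, hence zero (`eq_zero_of_symm_of_skew`).

The geometric lemmas translate both sides of the theorem into this algebra
(`twoJetsConformallyEquivalent_iff`, `quintuple_algebraicallyEquivalent_iff`). The inverse function
theorem realizes every pair `(L, R)`, with `L` invertible and `R` symmetric, by a local
diffeomorphism (`exists_isSmoothDiffeo`). Part (ii) is the same argument with `c` of either sign. -/

noncomputable section

namespace ConformalJets

/-! ### Algebra of jets at a zero of a conformal field. -/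

section JetAlgebra

/-- The `1`-jet `(form, dform)` of a metric, the `2`-jet `(0, lin, quad)` of a vector field vanishing
at a point and the `1`-jet `(lam, dlam)` of a function, subject to the `1`-jet of the equation
`L_v g = φ g`. -/
structure ConformalJet (E : Type*) [NormedAddCommGroup E] [NormedSpace ℝ E] where
  form : E →L[ℝ] E →L[ℝ] ℝ
  dform : E →L[ℝ] E →L[ℝ] E →L[ℝ] ℝ
  lin : E →L[ℝ] E
  quad : E →L[ℝ] E →L[ℝ] E
  lam : ℝ
  dlam : E →L[ℝ] ℝ
  form_symm (u w : E) : form u w = form w u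
  form_nondegenerate (u : E) (hu : ∀ w, form u w = 0) : u = 0
  dform_symm (z u w : E) : dform z u w = dform z w u
  quad_symm (u w : E) : quad u w = quad w u
  killing (u w : E) : form (lin u) w + form u (lin w) = lam * form u w
  dkilling (z u w : E) : dform (lin z) u w + dform z (lin u) w + dform z u (lin w)
    + form (quad z u) w + form u (quad z w) = dlam z * form u w + lam * dform z u w

variable {E : Type*} [NormedAddCommGroup E] [NormedSpace ℝ E]
  {E' : Type*} [NormedAddCommGroup E'] [NormedSpace ℝ E']

/-- A diffeomorphism with first derivative `L` and second derivative `R` sends the vector `2`-jet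
`(0, D, Q)` to `(0, D', Q')`. -/
structure MapsVectorJet (L : E →L[ℝ] E') (R : E →L[ℝ] E →L[ℝ] E') (D : E →L[ℝ] E)
    (Q : E →L[ℝ] E →L[ℝ] E) (D' : E' →L[ℝ] E') (Q' : E' →L[ℝ] E' →L[ℝ] E') : Prop where
  lin (u : E) : L (D u) = D' (L u)
  quad (z u : E) : R z (D u) + R u (D z) + L (Q z u) = Q' (L z) (L u) + D' (R z u)

/-- The pullback of the metric `1`-jet `(H₀, H₁)` by a diffeomorphism with derivatives `L` and `R`
is the product of the function `1`-jet `(c, c α)` and the metric `1`-jet `(G₀, G₁)`. -/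
structure PullsMetricJet (L : E →L[ℝ] E') (R : E →L[ℝ] E →L[ℝ] E') (c : ℝ) (α : E →L[ℝ] ℝ)
    (G₀ : E →L[ℝ] E →L[ℝ] ℝ) (G₁ : E →L[ℝ] E →L[ℝ] E →L[ℝ] ℝ)
    (H₀ : E' →L[ℝ] E' →L[ℝ] ℝ) (H₁ : E' →L[ℝ] E' →L[ℝ] E' →L[ℝ] ℝ) : Prop where
  form (u w : E) : H₀ (L u) (L w) = c * G₀ u w
  dform (z u w : E) : H₁ (L z) (L u) (L w) + H₀ (R z u) (L w) + H₀ (L u) (R z w)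
    = c * (G₁ z u w + α z * G₀ u w)

namespace ConformalJet

lemma exists_form_ne_zero [Nontrivial E] (J : ConformalJet E) : ∃ u w, J.form u w ≠ 0 := by
  obtain ⟨u, hu⟩ := exists_ne (0 : E)
  by_contra! h
  exact hu (J.form_nondegenerate u (h u))

/-- If `L`, `R` send metric jets to each other and the first order vector jets match, then the
mismatch of second order vector jets is governed by that of the functions `φ`. -/
lemma form_quad_mismatch (J : ConformalJet E) (J' : ConformalJet E') {L : E →L[ℝ] E'}
    {R : E →L[ℝ] E →L[ℝ] E'} (hR : ∀ z u, R z u = R u z) {c : ℝ} {α : E →L[ℝ] ℝ}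
    (hLR : PullsMetricJet L R c α J.form J.dform J'.form J'.dform)
    (hD : ∀ u, L (J.lin u) = J'.lin (L u)) (hlam : J'.lam = J.lam) (z u w : E) :
    J'.form (R z (J.lin u) + R u (J.lin z) + L (J.quad z u)
        - (J'.quad (L z) (L u) + J'.lin (R z u))) (L w)
      + J'.form (L u) (R z (J.lin w) + R w (J.lin z) + L (J.quad z w)
        - (J'.quad (L z) (L w) + J'.lin (R z w)))
      = c * (J.dlam z + α (J.lin z) - J'.dlam (L z)) * J.form u w := by
  have e := J'.dkilling (L z) (L u) (L w)
  have e0 := J.dkilling z u w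
  simp only [← hD, hlam] at e
  have k1 := J'.killing (L u) (R z w)
  have k2 := J'.killing (R z u) (L w)
  simp only [← hD, hlam] at k1 k2
  -- The metric condition is used at the three triples in which the differentiated conformal
  -- equation inserts `J.lin`, and once at `(z, u, w)` for the term `lam * dform`.
  have d1 := hLR.dform (J.lin z) u w
  have d2 := hLR.dform z (J.lin u) w
  have d3 := hLR.dform z u (J.lin w)
  have d4 := hLR.dform z u w
  have f1 := hLR.form u w
  have f2 := hLR.form (J.quad z u) w
  have f3 := hLR.form u (J.quad z w)
  have k3 := J.killing u w
  rw [hR (J.lin z) u, hR (J.lin z) w] at d1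
  simp only [map_add, map_sub, add_apply, sub_apply]
  -- The equation `e` at the images under `L` is subtracted from `c` times the source equation `e0`.
  -- The `α` terms of `d1`, `d2`, `d3`, `d4` reduce by `k3` to `α (J.lin z)`.
  linear_combination (-1) * e + d1 + d2 + d3 - J.lam * d4 + f2 + f3 - J'.dlam (L z) * f1 - k1 - k2
    + c * α z * k3 + c * e0

end ConformalJet

-- The transpositions `s` of the first two and `t` of the last two arguments satisfy `sts = tst`.
-- The left side multiplies `T` by `-1`, the right side by `+1`.
omit [NormedAddCommGroup E] [NormedSpace ℝ E] in
lemma eq_zero_of_symm_of_skew {T : E → E → E → ℝ} (hs : ∀ z u w, T z u w = T u z w)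
    (ha : ∀ z u w, T z u w + T z w u = 0) (z u w : E) : T z u w = 0 := by
  linarith [hs z u w, ha u z w, hs u w z, ha w u z, hs w z u, ha z w u]

/-- The algebraic part of the existence of the Levi-Civita connection. -/
lemma exists_koszul_solution [FiniteDimensional ℝ E] [FiniteDimensional ℝ E']
    {H : E' →L[ℝ] E' →L[ℝ] ℝ} (hs : ∀ u w, H u w = H w u) (hH : ∀ u, (∀ w, H u w = 0) → u = 0)
    (L : E ≃L[ℝ] E') {S : E → E → E → ℝ} (hS : ∀ z u w, S z u w = S z w u)
    (hadd : ∀ z z' u w, S (z + z') u w = S z u w + S z' u w)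
    (hsmul : ∀ (t : ℝ) z u w, S (t • z) u w = t * S z u w)
    (hadd' : ∀ z u w w', S z u (w + w') = S z u w + S z u w')
    (hsmul' : ∀ (t : ℝ) z u w, S z u (t • w) = t * S z u w) :
    ∃ R : E →L[ℝ] E →L[ℝ] E', (∀ z u, R z u = R u z) ∧
      ∀ z u w, H (R z u) (L w) + H (L u) (R z w) = S z u w := by
  -- Nondegeneracy of `H` and equality of dimensions make `e ↦ H e (L ·)` an isomorphism onto the
  -- dual of `E`, so `R z u` may be prescribed by its pairings with all `L w`.
  let A : E' →ₗ[ℝ] (E →ₗ[ℝ] ℝ) :=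
    LinearMap.mk₂ ℝ (fun e w ↦ H e (L w)) (by simp) (by simp) (by simp) (by simp)
  have hA : Function.Injective A := by
    rw [injective_iff_map_eq_zero]
    intro e he
    refine hH e fun w ↦ ?_
    simpa [A] using LinearMap.congr_fun he (L.symm w)
  have hdim : Module.finrank ℝ E' = Module.finrank ℝ (E →ₗ[ℝ] ℝ) := by
    rw [← L.toLinearEquiv.finrank_eq]
    exact (Subspace.dual_finrank_eq (K := ℝ) (V := E)).symm
  let A' : E' ≃ₗ[ℝ] (E →ₗ[ℝ] ℝ) := LinearEquiv.ofInjectiveOfFinrankEq A hA hdim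
  have hA' (f : E →ₗ[ℝ] ℝ) (w : E) : H (A'.symm f) (L w) = f w := by
    have : A (A'.symm f) = f := A'.apply_symm_apply f
    exact LinearMap.congr_fun this w
  have hadd'' (z u u' w) : S z (u + u') w = S z u w + S z u' w := by
    simp only [hS z _ w, hadd']
  have hsmul'' (t : ℝ) (z u w) : S z (t • u) w = t * S z u w := by
    simp only [hS z _ w, hsmul']
  -- The Koszul combination: it is symmetric in `z, u`, and on symmetrizing in `u, w` everything
  -- cancels except `S z u w`.
  let B₀ (z u : E) : E →ₗ[ℝ] ℝ :=
    { toFun := fun w ↦ 1 / 2 * (S z u w + S u z w - S w z u)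
      map_add' := fun w w' ↦ by rw [hadd', hadd', hadd]; ring
      map_smul' := fun t w ↦ by
        rw [hsmul', hsmul', hsmul, RingHom.id_apply, smul_eq_mul]; ring }
  have hB₀ (z u w : E) : B₀ z u w = 1 / 2 * (S z u w + S u z w - S w z u) := rfl
  let B : E →ₗ[ℝ] E →ₗ[ℝ] (E →ₗ[ℝ] ℝ) := LinearMap.mk₂ ℝ B₀
    (fun z z' u ↦ by
      ext w; rw [LinearMap.add_apply, hB₀, hB₀, hB₀, hadd, hadd'', hadd'']; ring)
    (fun t z u ↦ by
      ext w; rw [LinearMap.smul_apply, hB₀, hB₀, hsmul, hsmul'', hsmul'', smul_eq_mul]; ring)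
    (fun z u u' ↦ by
      ext w; rw [LinearMap.add_apply, hB₀, hB₀, hB₀, hadd, hadd'', hadd']; ring)
    (fun t z u ↦ by
      ext w; rw [LinearMap.smul_apply, hB₀, hB₀, hsmul, hsmul'', hsmul', smul_eq_mul]; ring)
  have hB (z u w : E) : B z u w = 1 / 2 * (S z u w + S u z w - S w z u) := rfl
  let R : E →L[ℝ] E →L[ℝ] E' :=
    LinearMap.toContinuousLinearMap
      ((LinearMap.toContinuousLinearMap (𝕜 := ℝ) (E := E) (F' := E')).toLinearMap ∘ₗ
        B.compr₂ A'.symm.toLinearMap)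
  have hR (z u : E) : R z u = A'.symm (B z u) := rfl
  refine ⟨R, fun z u ↦ ?_, fun z u w ↦ ?_⟩
  · rw [hR, hR]
    congr 1
    ext w
    rw [hB, hB, hS w z u]
    ring
  · rw [hs (L u), hR, hR, hA', hA', hB, hB, hS z w u]
    ring

/-- The range of the dual map of `D` is the annihilator of `Ker D`. This supplies the differential
of `τ`, and it is why only the restriction of `dφ` to `Ker D` is an invariant. -/
lemma exists_comp_eq_of_ker_le [FiniteDimensional ℝ E] (D : E →L[ℝ] E) (f : E →L[ℝ] ℝ)
    (hf : ∀ z, D z = 0 → f z = 0) : ∃ α : E →L[ℝ] ℝ, ∀ z, α (D z) = f z := by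
  have h : (f : E →ₗ[ℝ] ℝ) ∈ LinearMap.range (D : E →ₗ[ℝ] E).dualMap := by
    rw [LinearMap.range_dualMap_eq_dualAnnihilator_ker, Submodule.mem_dualAnnihilator]
    exact fun z hz ↦ hf z hz
  obtain ⟨α, hα⟩ := h
  exact ⟨LinearMap.toContinuousLinearMap α, fun z ↦ LinearMap.congr_fun hα z⟩

namespace ConformalJet

set_option synthInstance.maxHeartbeats 200000 in
/-- Equivalence of jets under `2`-jets of diffeomorphisms that are conformal to first order amounts
to equivalence of the data at the point under a linear conformal isomorphism. -/
theorem exists_mapsJet_iff [FiniteDimensional ℝ E] [FiniteDimensional ℝ E'] [Nontrivial E]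
    (J : ConformalJet E) (J' : ConformalJet E') {C : Set ℝ} (hC : 0 ∉ C) :
    (∃ (L : E ≃L[ℝ] E') (R : E →L[ℝ] E →L[ℝ] E') (α : E →L[ℝ] ℝ), (∀ z u, R z u = R u z) ∧
      MapsVectorJet L R J.lin J.quad J'.lin J'.quad ∧
      ∃ c ∈ C, PullsMetricJet L R c α J.form J.dform J'.form J'.dform) ↔
    J'.lam = J.lam ∧ ∃ L : E ≃L[ℝ] E', (∃ c ∈ C, ∀ u w, J'.form (L u) (L w) = c * J.form u w) ∧
      (∀ u, L (J.lin u) = J'.lin (L u)) ∧ ∀ z, J.lin z = 0 → J'.dlam (L z) = J.dlam z := by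
  constructor
  · rintro ⟨L, R, α, hR, hv, c, hc, hm⟩
    have hc0 : c ≠ 0 := fun h ↦ hC (h ▸ hc)
    -- A single nonzero value of the metric suffices to cancel it from the scalar identities for
    -- `lam` and `dlam`.
    obtain ⟨u, w, huw⟩ := J.exists_form_ne_zero
    have hlin : ∀ u, L (J.lin u) = J'.lin (L u) := hv.lin
    have hform : ∀ u w, J'.form (L u) (L w) = c * J.form u w := hm.form
    have hlam : J'.lam = J.lam := by
      have h1 := J'.killing (L u) (L w)
      rw [← hlin, ← hlin, hform, hform, hform, ← mul_add, J.killing] at h1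
      have : c * J.form u w * (J'.lam - J.lam) = 0 := by linear_combination -h1
      simpa [hc0, huw, sub_eq_zero] using this
    refine ⟨hlam, L, ⟨c, hc, hform⟩, hlin, fun z hz ↦ ?_⟩
    have h := J.form_quad_mismatch J' hR hm hv.lin hlam z u w
    have hq (z u : E) : R z (J.lin u) + R u (J.lin z) + L (J.quad z u)
        - (J'.quad (L z) (L u) + J'.lin (R z u)) = 0 := sub_eq_zero.2 (hv.quad z u)
    simp only [ContinuousLinearEquiv.coe_coe, hq] at h
    -- With `J.lin z = 0` the unknown `α` drops out of the mismatch identity.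
    simp only [map_zero, zero_apply, hz, add_zero] at h
    have h2 := h.symm
    simp only [mul_eq_zero, hc0, huw, or_false, false_or] at h2
    linarith
  · rintro ⟨hlam, L, ⟨c, hc, hform⟩, hlin, hdlam⟩
    have hc0 : c ≠ 0 := fun h ↦ hC (h ▸ hc)
    -- This choice of `α` makes the right-hand side of `form_quad_mismatch` vanish identically.
    obtain ⟨α, hα⟩ := exists_comp_eq_of_ker_le J.lin (J'.dlam.comp (L : E →L[ℝ] E') - J.dlam)
      (fun z hz ↦ by simp [hdlam z hz])
    obtain ⟨R, hR, hRS⟩ := exists_koszul_solution J'.form_symm J'.form_nondegenerate L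
      -- `S` is what the first-order metric condition requires of the two terms containing `R`.
      (S := fun z u w ↦ c * (J.dform z u w + α z * J.form u w) - J'.dform (L z) (L u) (L w))
      (fun z u w ↦ by
        rw [J.dform_symm z u w, J.form_symm u w, J'.dform_symm (L z) (L u) (L w)])
      (fun z z' u w ↦ by simp only [map_add, add_apply]; ring)
      (fun t z u w ↦ by simp only [map_smul, smul_apply, smul_eq_mul]; ring)
      (fun z u w w' ↦ by simp only [map_add]; ring)
      (fun t z u w ↦ by simp only [map_smul, smul_eq_mul]; ring)
    have hm : PullsMetricJet (L : E →L[ℝ] E') R c α J.form J.dform J'.form J'.dform :=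
      ⟨hform, fun z u w ↦ by
        simp only [ContinuousLinearEquiv.coe_coe]
        linarith [hRS z u w]⟩
    refine ⟨L, R, α, hR, ⟨hlin, fun z u ↦ ?_⟩, c, hc, hm⟩
    have key := J.form_quad_mismatch J' hR hm hlin hlam
    refine sub_eq_zero.1 (J'.form_nondegenerate _ fun w' ↦ ?_)
    obtain ⟨w, rfl⟩ := L.surjective w'
    -- The defect is symmetric in `z, u` because second derivatives are, and skew in `u, w` by the
    -- choice of `α`.
    refine eq_zero_of_symm_of_skew (T := fun z u w ↦ J'.form (R z (J.lin u) + R u (J.lin z)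
      + L (J.quad z u) - (J'.quad (L z) (L u) + J'.lin (R z u))) (L w)) (fun z u w ↦ ?_)
      (fun z u w ↦ ?_) z u w
    · simp only [hR z u, J.quad_symm z u, J'.quad_symm (L z) (L u), add_comm (R z (J.lin u))]
    · have h := key z u w
      rw [J'.form_symm _ (_ - _)] at h
      refine h.trans ?_
      rw [hα]
      simp

end ConformalJet

end JetAlgebra

/-! ### Differentiating the field, metric and pullback equations in a vector space. -/

section JetCalculus

open Filter Topology

variable {E : Type*} [NormedAddCommGroup E] [NormedSpace ℝ E]
  {F : Type*} [NormedAddCommGroup F] [NormedSpace ℝ F]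

lemma iteratedFDeriv_le_one_eq_iff {f g : E → F} {a : E} :
    (∀ j ≤ 1, iteratedFDeriv ℝ j f a = iteratedFDeriv ℝ j g a) ↔
      f a = g a ∧ fderiv ℝ f a = fderiv ℝ g a := by
  constructor
  · intro h
    refine ⟨?_, ?_⟩
    · simpa using congrArg (fun m ↦ m 0) (h 0 (by norm_num))
    · ext u
      simpa using congrArg (fun m ↦ m ![u]) (h 1 le_rfl)
  · rintro ⟨h0, h1⟩ j hj
    interval_cases j
    · ext m; simp [h0]
    · ext m; simp [h1]

lemma iteratedFDeriv_le_two_eq_iff {f g : E → F} {a : E} :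
    (∀ j ≤ 2, iteratedFDeriv ℝ j f a = iteratedFDeriv ℝ j g a) ↔
      f a = g a ∧ fderiv ℝ f a = fderiv ℝ g a ∧
        fderiv ℝ (fderiv ℝ f) a = fderiv ℝ (fderiv ℝ g) a := by
  constructor
  · intro h
    obtain ⟨h0, h1⟩ := iteratedFDeriv_le_one_eq_iff.1 fun j hj ↦ h j (hj.trans one_le_two)
    refine ⟨h0, h1, ?_⟩
    ext u w
    simpa [iteratedFDeriv_two_apply] using congrArg (fun m ↦ m ![u, w]) (h 2 le_rfl)
  · rintro ⟨h0, h1, h2⟩ j hj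
    rcases hj.lt_or_eq with hj | rfl
    · exact iteratedFDeriv_le_one_eq_iff.2 ⟨h0, h1⟩ j (Nat.lt_succ_iff.1 hj)
    · ext m; simp [iteratedFDeriv_two_apply, h2]

lemma hasFDerivAt_fderiv {f : E → F} {a : E} (hf : ContDiffAt ℝ 2 f a) :
    HasFDerivAt (fderiv ℝ f) (fderiv ℝ (fderiv ℝ f) a) a :=
  ((hf.fderiv_right (m := 1) (by norm_num)).differentiableAt (by norm_num)).hasFDerivAt

lemma _root_.ContDiffAt.hasFDerivAt_of_two {f : E → F} {a : E} (hf : ContDiffAt ℝ 2 f a) :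
    HasFDerivAt f (fderiv ℝ f a) a :=
  (hf.differentiableAt (by norm_num)).hasFDerivAt

lemma hasFDerivAt_fderiv_comp {E' : Type*} [NormedAddCommGroup E'] [NormedSpace ℝ E']
    (f : E' → F) {ψ : E → E'} {a : E} (hf : DifferentiableAt ℝ f (ψ a))
    (hψ : DifferentiableAt ℝ ψ a) :
    HasFDerivAt (fun z ↦ f (ψ z)) ((fderiv ℝ f (ψ a)).comp (fderiv ℝ ψ a)) a :=
  hf.hasFDerivAt.comp a hψ.hasFDerivAt

/-- The term with the second derivative of `f` is applied to `V a = 0`. Hence only the 1-jet of the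
metric enters the differentiated conformal equation. -/
lemma hasFDerivAt_fderiv_apply_of_eq_zero (f : E → F) {V : E → E} {a : E}
    (hf : ContDiffAt ℝ 2 f a) (hV : DifferentiableAt ℝ V a) (ha : V a = 0) :
    HasFDerivAt (fun z ↦ fderiv ℝ f z (V z)) ((fderiv ℝ f a).comp (fderiv ℝ V a)) a := by
  refine ((hasFDerivAt_fderiv hf).clm_apply hV.hasFDerivAt).congr_fderiv ?_
  simp [ha]

set_option synthInstance.maxHeartbeats 200000 in
lemma exists_hasFDerivAt_bilin {B : E → F →L[ℝ] F →L[ℝ] ℝ} {B' : E →L[ℝ] F →L[ℝ] F →L[ℝ] ℝ}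
    {u w : E → F} {u' w' : E →L[ℝ] F} {a : E}
    (hB : HasFDerivAt B B' a) (hu : HasFDerivAt u u' a) (hw : HasFDerivAt w w' a) :
    ∃ D : E →L[ℝ] ℝ, HasFDerivAt (fun z ↦ B z (u z) (w z)) D a ∧
      ∀ z, D z = B' z (u a) (w a) + B a (u' z) (w a) + B a (u a) (w' z) := by
  refine ⟨_, (HasFDerivAt.clm_apply hB hu).clm_apply hw, fun z ↦ ?_⟩
  simp
  ring

set_option synthInstance.maxHeartbeats 200000 in
/-- The first order consequence, at a zero `a` of `V`, of the equation `L_V G = Φ G`. -/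
lemma killing_one_jet {G : E → E →L[ℝ] E →L[ℝ] ℝ} {V : E → E} {Φ : E → ℝ} {a : E}
    (hG : ContDiffAt ℝ 2 G a) (hV : ContDiffAt ℝ 2 V a) (hΦ : DifferentiableAt ℝ Φ a)
    (ha : V a = 0)
    (h : ∀ᶠ z in 𝓝 a, ∀ u w, G z (fderiv ℝ V z u) w + G z u (fderiv ℝ V z w)
      + fderiv ℝ G z (V z) u w = Φ z * G z u w) (z u w : E) :
    fderiv ℝ G a (fderiv ℝ V a z) u w + fderiv ℝ G a z (fderiv ℝ V a u) w
      + fderiv ℝ G a z u (fderiv ℝ V a w) + G a (fderiv ℝ (fderiv ℝ V) a z u) w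
      + G a u (fderiv ℝ (fderiv ℝ V) a z w)
      = fderiv ℝ Φ a z * G a u w + Φ a * fderiv ℝ G a z u w := by
  have dG := hG.hasFDerivAt_of_two
  have dV' := hasFDerivAt_fderiv hV
  have cst (e : E) : HasFDerivAt (fun _ : E ↦ e) (0 : E →L[ℝ] E) a := hasFDerivAt_const e a
  obtain ⟨D₁, h1, e1⟩ := exists_hasFDerivAt_bilin dG (dV'.clm_apply (cst u)) (cst w)
  obtain ⟨D₂, h2, e2⟩ := exists_hasFDerivAt_bilin dG (cst u) (dV'.clm_apply (cst w))
  obtain ⟨D₃, h3, e3⟩ := exists_hasFDerivAt_bilin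
    (hasFDerivAt_fderiv_apply_of_eq_zero G hG (hV.differentiableAt (by norm_num)) ha)
    (cst u) (cst w)
  obtain ⟨D₄, h4, e4⟩ := exists_hasFDerivAt_bilin dG (cst u) (cst w)
  have h5 := ((h1.add h2).add h3).congr_of_eventuallyEq
    (f₁ := fun z ↦ Φ z * G z u w) (h.mono fun z hz ↦ (hz u w).symm)
  have := DFunLike.congr_fun ((hΦ.hasFDerivAt.mul h4).unique h5) z
  simp [ha, e1, e2, e3, e4] at this
  linarith

variable {E' : Type*} [NormedAddCommGroup E'] [NormedSpace ℝ E']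

/-- The `2`-jet of a vector field and of its image under a map are related by the derivatives of
the map. -/
lemma mapsVectorJet_of_eventuallyEq {ψ : E → E'} {V : E → E} {X : E' → E'} {a : E}
    (hψ : ContDiffAt ℝ 3 ψ a) (hV : ContDiffAt ℝ 2 V a) (hX : ContDiffAt ℝ 2 X (ψ a))
    (ha : V a = 0) (h : ∀ᶠ z in 𝓝 a, X (ψ z) = fderiv ℝ ψ z (V z)) :
    MapsVectorJet (fderiv ℝ ψ a) (fderiv ℝ (fderiv ℝ ψ) a) (fderiv ℝ V a)
      (fderiv ℝ (fderiv ℝ V) a) (fderiv ℝ X (ψ a)) (fderiv ℝ (fderiv ℝ X) (ψ a)) := by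
  have hψ2 : ContDiffAt ℝ 2 ψ a := hψ.of_le (by norm_num)
  have hψ' : ContDiffAt ℝ 2 (fderiv ℝ ψ) a := hψ.fderiv_right (by norm_num)
  have cst (e : E) : HasFDerivAt (fun _ : E ↦ e) (0 : E →L[ℝ] E) a := hasFDerivAt_const e a
  -- The first derivative of the relation is needed on a whole neighbourhood, because it is
  -- differentiated once more at `a`.
  have hev : ∀ᶠ z in 𝓝 a, ∀ u, fderiv ℝ X (ψ z) (fderiv ℝ ψ z u)
      = fderiv ℝ (fderiv ℝ ψ) z u (V z) + fderiv ℝ ψ z (fderiv ℝ V z u) := by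
    filter_upwards [h.eventually_nhds, hψ2.eventually (by simp), hψ'.eventually (by simp),
      hV.eventually (by simp),
      hψ.continuousAt.eventually (hX.eventually (by simp))] with z h1 h2 h3 h4 h5 u
    have e1 := h5.hasFDerivAt_of_two.comp z h2.hasFDerivAt_of_two
    have e2 := h3.hasFDerivAt_of_two.clm_apply h4.hasFDerivAt_of_two
    have e3 := DFunLike.congr_fun (e1.unique (e2.congr_of_eventuallyEq h1)) u
    simpa [add_comm] using e3
  refine ⟨fun u ↦ ?_, fun z u ↦ ?_⟩
  · simpa [ha] using (hev.self_of_nhds u).symm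
  · have e1 := ((hasFDerivAt_fderiv hX).comp a hψ2.hasFDerivAt_of_two).clm_apply
      ((hasFDerivAt_fderiv hψ2).clm_apply (cst u))
    have e2 := (((hasFDerivAt_fderiv hψ').clm_apply (cst u)).clm_apply hV.hasFDerivAt_of_two).add
      (hψ'.hasFDerivAt_of_two.clm_apply ((hasFDerivAt_fderiv hV).clm_apply (cst u)))
    have e3 := DFunLike.congr_fun
      (e1.unique (e2.congr_of_eventuallyEq (hev.mono fun z hz ↦ hz u))) z
    -- The third derivative of `ψ` is applied to `V a = 0` and disappears.
    simp [ha] at e3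
    rw [add_comm (fderiv ℝ (fderiv ℝ X) (ψ a) _ _), e3,
      (hψ2.isSymmSndFDerivAt (by simp)) z (fderiv ℝ V a u), (hψ2.isSymmSndFDerivAt (by simp)) u]
    abel

/-- Surjectivity of `L` makes the transported jet unique. A field satisfying the transport relations
therefore has the same jet as the push-forward. -/
lemma ext_of_mapsVectorJet (L : E ≃L[ℝ] E') {R : E →L[ℝ] E →L[ℝ] E'} {D : E →L[ℝ] E}
    {Q : E →L[ℝ] E →L[ℝ] E} {D₁ D₂ : E' →L[ℝ] E'} {Q₁ Q₂ : E' →L[ℝ] E' →L[ℝ] E'}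
    (h₁ : MapsVectorJet (L : E →L[ℝ] E') R D Q D₁ Q₁)
    (h₂ : MapsVectorJet (L : E →L[ℝ] E') R D Q D₂ Q₂) : D₁ = D₂ ∧ Q₁ = Q₂ := by
  have hD : D₁ = D₂ := by
    ext u
    obtain ⟨u, rfl⟩ := L.surjective u
    exact (h₁.lin u).symm.trans (h₂.lin u)
  refine ⟨hD, ?_⟩
  ext z u
  obtain ⟨u, rfl⟩ := L.surjective u
  obtain ⟨z, rfl⟩ := L.surjective z
  have := (h₁.quad z u).symm.trans (h₂.quad z u)
  rw [hD] at this
  exact add_right_cancel this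

set_option synthInstance.maxHeartbeats 200000 in
/-- The value and the first derivative of the pullback of a family `H` of bilinear forms. -/
lemma pullback_one_jet {ψ : E → E'} {H : E' → E' →L[ℝ] E' →L[ℝ] ℝ}
    {P : E → E →L[ℝ] E →L[ℝ] ℝ} {a : E}
    (hψ : ContDiffAt ℝ 2 ψ a) (hH : DifferentiableAt ℝ H (ψ a)) (hP : DifferentiableAt ℝ P a)
    (h : ∀ᶠ z in 𝓝 a, ∀ u w, P z u w = H (ψ z) (fderiv ℝ ψ z u) (fderiv ℝ ψ z w)) (z u w : E) :
    fderiv ℝ P a z u w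
      = fderiv ℝ H (ψ a) (fderiv ℝ ψ a z) (fderiv ℝ ψ a u) (fderiv ℝ ψ a w)
        + H (ψ a) (fderiv ℝ (fderiv ℝ ψ) a z u) (fderiv ℝ ψ a w)
        + H (ψ a) (fderiv ℝ ψ a u) (fderiv ℝ (fderiv ℝ ψ) a z w) := by
  have cst (e : E) : HasFDerivAt (fun _ : E ↦ e) (0 : E →L[ℝ] E) a := hasFDerivAt_const e a
  have dψ' := hasFDerivAt_fderiv hψ
  obtain ⟨D₁, h1, e1⟩ := exists_hasFDerivAt_bilin hP.hasFDerivAt (cst u) (cst w)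
  obtain ⟨D₂, h2, e2⟩ := exists_hasFDerivAt_bilin
    (hasFDerivAt_fderiv_comp H hH (hψ.differentiableAt (by norm_num))) (dψ'.clm_apply (cst u)) (dψ'.clm_apply (cst w))
  have e3 := DFunLike.congr_fun
    (h1.unique (h2.congr_of_eventuallyEq (h.mono fun z hz ↦ hz u w))) z
  simpa [e1, e2] using e3

lemma fderiv_exp_smul {G : E → F} {T : E → ℝ} {a : E} (hG : DifferentiableAt ℝ G a)
    (hT : DifferentiableAt ℝ T a) (z : E) :
    fderiv ℝ (fun z ↦ Real.exp (T z) • G z) a z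
      = Real.exp (T a) • (fderiv ℝ G a z + fderiv ℝ T a z • G a) := by
  have := DFunLike.congr_fun (hT.hasFDerivAt.exp.smul hG.hasFDerivAt).fderiv z
  refine this.trans ?_
  simp [smul_smul]

end JetCalculus

/-! ### Sections, tangent vectors and bilinear forms in charts. -/

section LocalRepresentatives

open Filter Topology

variable {E : Type*} [NormedAddCommGroup E] [NormedSpace ℝ E]
  {M : Type*} [TopologicalSpace M] [ChartedSpace E M]

lemma extChartAt_target_mem_nhds_self (x : M) :
    (extChartAt 𝓘(ℝ, E) x).target ∈ 𝓝 (extChartAt 𝓘(ℝ, E) x x) :=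
  extChartAt_target_mem_nhds x

variable [IsManifold 𝓘(ℝ, E) ∞ M]

instance isManifold_one : IsManifold 𝓘(ℝ, E) 1 M := .of_le (n := ∞) (by simp)

lemma contDiffAt_comp_extChartAt_symm {F : Type*} [NormedAddCommGroup F] [NormedSpace ℝ F]
    {f : M → F} {x : M} (hf : ContMDiffAt 𝓘(ℝ, E) 𝓘(ℝ, F) ∞ f x) :
    ContDiffAt ℝ ∞ (fun z ↦ f ((extChartAt 𝓘(ℝ, E) x).symm z)) (extChartAt 𝓘(ℝ, E) x x) := by
  rw [← contMDiffAt_iff_contDiffAt]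
  refine ContMDiffAt.comp (I' := 𝓘(ℝ, E)) _ (g := f) ?_ ?_
  · simpa using hf
  · exact (contMDiffOn_extChartAt_symm x).contMDiffAt (extChartAt_target_mem_nhds_self x)

lemma contDiffAt_localRep {F : Type*} [NormedAddCommGroup F] [NormedSpace ℝ F] {V : M → Type*}
    [TopologicalSpace (TotalSpace F V)] [∀ p, TopologicalSpace (V p)] [FiberBundle F V]
    {s : Π p, V p} {x : M}
    (hs : ContMDiffAt 𝓘(ℝ, E) (𝓘(ℝ, E).prod 𝓘(ℝ, F)) ∞ (fun p ↦ TotalSpace.mk' F p (s p)) x) :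
    ContDiffAt ℝ ∞ (localRep (E := E) F s x) (extChartAt 𝓘(ℝ, E) x x) := by
  rw [contMDiffAt_section] at hs
  exact contDiffAt_comp_extChartAt_symm hs

/-- The coordinate representation of tangent vectors at `p` in the chart at `x`. -/
def toChart (x p : M) : TangentSpace 𝓘(ℝ, E) p →L[ℝ] E :=
  (trivializationAt E (TangentSpace 𝓘(ℝ, E)) x).continuousLinearMapAt ℝ p

/-- The tangent vector at `p` with given coordinates in the chart at `x`. -/
def ofChart (x p : M) : E →L[ℝ] TangentSpace 𝓘(ℝ, E) p :=
  (trivializationAt E (TangentSpace 𝓘(ℝ, E)) x).symmL ℝ p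

lemma toChart_ofChart {x p : M} (hp : p ∈ (chartAt E x).source) (u : E) :
    toChart x p (ofChart x p u) = u :=
  Trivialization.continuousLinearMapAt_symmL _ (by simpa using hp) u

lemma ofChart_toChart {x p : M} (hp : p ∈ (chartAt E x).source) (u : TangentSpace 𝓘(ℝ, E) p) :
    ofChart x p (toChart x p u) = u :=
  Trivialization.symmL_continuousLinearMapAt _ (by simpa using hp) u

lemma toChart_eq_mfderiv {x p : M} (hp : p ∈ (chartAt E x).source) :
    toChart (E := E) x p = mfderiv 𝓘(ℝ, E) 𝓘(ℝ, E) (extChartAt 𝓘(ℝ, E) x) p :=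
  TangentBundle.continuousLinearMapAt_trivializationAt hp

/-- The chart at `x` has identity derivative at `x`, so the data of the quintuple at `x` are
coordinate data without any change of basis. -/
lemma toChart_self (x : M) (u : TangentSpace 𝓘(ℝ, E) x) : toChart (E := E) x x u = u := by
  have h := toChart_eq_mfderiv (mem_chart_source E x)
  rw [mfderiv_extChartAt_self] at h
  exact DFunLike.congr_fun h u

lemma ofChart_self (x : M) (u : E) : ofChart x x u = u :=
  (toChart_self (E := E) x (ofChart (E := E) x x u)).symm.trans
    (toChart_ofChart (mem_chart_source E x) u)

omit [IsManifold 𝓘(ℝ, E) ∞ M] in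
lemma extChartAt_symm_mem_chart_source {x : M} {z : E}
    (hz : z ∈ (extChartAt 𝓘(ℝ, E) x).target) :
    (extChartAt 𝓘(ℝ, E) x).symm z ∈ (chartAt E x).source := by
  simpa using (extChartAt 𝓘(ℝ, E) x).map_target hz

lemma localRep_vectorField (v : Π p : M, TangentSpace 𝓘(ℝ, E) p) (x : M) {z : E}
    (hz : z ∈ (extChartAt 𝓘(ℝ, E) x).target) :
    localRep (E := E) E v x z = toChart x ((extChartAt 𝓘(ℝ, E) x).symm z)
      (v ((extChartAt 𝓘(ℝ, E) x).symm z)) := by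
  have h := extChartAt_symm_mem_chart_source hz
  rw [toChart, Trivialization.continuousLinearMapAt_apply, Trivialization.linearMapAt_apply,
    if_pos (by simpa using h), localRep]

lemma localRep_bilinearForm
    (B : Π p : M, TangentSpace 𝓘(ℝ, E) p →L[ℝ] TangentSpace 𝓘(ℝ, E) p →L[ℝ] ℝ) (x : M) {z : E}
    (hz : z ∈ (extChartAt 𝓘(ℝ, E) x).target) (u w : E) :
    localRep (E := E) (E →L[ℝ] E →L[ℝ] ℝ)
      (V := fun p : M ↦ TangentSpace 𝓘(ℝ, E) p →L[ℝ] TangentSpace 𝓘(ℝ, E) p →L[ℝ] ℝ) B x z u w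
      = B ((extChartAt 𝓘(ℝ, E) x).symm z) (ofChart x _ u) (ofChart x _ w) := by
  have h := extChartAt_symm_mem_chart_source hz
  have hu (u : E) : ofChart x ((extChartAt 𝓘(ℝ, E) x).symm z) u
      = (trivializationAt E (TangentSpace 𝓘(ℝ, E)) x).symm ((extChartAt 𝓘(ℝ, E) x).symm z) u :=
    Trivialization.symmL_apply _ (by simpa using h) u
  rw [localRep, hom_trivializationAt_apply,
    inCoordinates_apply_eq₂ (by simpa using h) (by simpa using h) (by simp), hu, hu]
  simp

end LocalRepresentatives

/-! ### The Levi-Civita connection in coordinates. -/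

section CoordinateKoszul

open Filter Topology

variable {E : Type*} [NormedAddCommGroup E] [NormedSpace ℝ E]
  {M : Type*} [TopologicalSpace M] [ChartedSpace E M] [IsManifold 𝓘(ℝ, E) ∞ M]

omit [NormedSpace ℝ E] [IsManifold 𝓘(ℝ, E) ∞ M] in
lemma chart_source_mem_nhds {x p : M} (hp : p ∈ (chartAt E x).source) :
    (chartAt E x).source ∈ 𝓝 p :=
  (chartAt E x).open_source.mem_nhds hp

lemma two_le_infty : (2 : WithTop ℕ∞) ≤ ∞ := by
  exact WithTop.coe_le_coe.2 (le_top : (2 : ℕ∞) ≤ ⊤)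

lemma mvfderiv_eq_fderiv {f : M → ℝ} {f' : E → ℝ} {x p : M} (hp : p ∈ (chartAt E x).source)
    (hf' : DifferentiableAt ℝ f' (extChartAt 𝓘(ℝ, E) x p))
    (hf : ∀ᶠ q in 𝓝 p, f q = f' (extChartAt 𝓘(ℝ, E) x q)) (u : TangentSpace 𝓘(ℝ, E) p) :
    mvfderiv 𝓘(ℝ, E) f p u = fderiv ℝ f' (extChartAt 𝓘(ℝ, E) x p) (toChart x p u) := by
  have h1 : mfderiv 𝓘(ℝ, E) 𝓘(ℝ, ℝ) (f' ∘ extChartAt 𝓘(ℝ, E) x) p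
      = (fderiv ℝ f' (extChartAt 𝓘(ℝ, E) x p)).comp (toChart (E := E) x p) := by
    rw [toChart_eq_mfderiv hp, mfderiv_comp p hf'.mdifferentiableAt
      (mdifferentiableAt_extChartAt hp), mfderiv_eq_fderiv]
    rfl
  have h2 : mfderiv 𝓘(ℝ, E) 𝓘(ℝ, ℝ) f p
      = mfderiv 𝓘(ℝ, E) 𝓘(ℝ, ℝ) (f' ∘ extChartAt 𝓘(ℝ, E) x) p :=
    Filter.EventuallyEq.mfderiv_eq hf
  exact DFunLike.congr_fun (h2.trans h1) u

lemma mdifferentiableAt_ofChart {x p : M} (hp : p ∈ (chartAt E x).source) (u : E) :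
    MDiffAt (T% (fun q ↦ (ofChart x q u : TangentSpace 𝓘(ℝ, E) q))) p := by
  rw [(trivializationAt E (TangentSpace 𝓘(ℝ, E)) x).mdifferentiableAt_section_iff 𝓘(ℝ, E) _
    (by simpa using hp)]
  refine (mdifferentiableAt_const (c := u)).congr_of_eventuallyEq ?_
  filter_upwards [chart_source_mem_nhds hp] with q hq
  refine Eq.trans ?_ (toChart_ofChart hq u)
  rw [toChart, Trivialization.continuousLinearMapAt_apply, Trivialization.linearMapAt_apply,
    if_pos (by simpa using hq)]

lemma mdifferentiableAt_section_of_differentiableAt {W : Π z : E, TangentSpace 𝓘(ℝ, E) z} {a : E}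
    (hW : DifferentiableAt ℝ (W : E → E) a) : MDiffAt (T% W) a := by
  rw [mdifferentiableAt_section]
  simpa using! hW.mdifferentiableAt

lemma mpullback_extChartAt (W : Π z : E, TangentSpace 𝓘(ℝ, E) z) {x p : M} (hp : p ∈ (chartAt E x).source) :
    mpullback 𝓘(ℝ, E) 𝓘(ℝ, E) (extChartAt 𝓘(ℝ, E) x) W p
      = ofChart (E := E) x p (W (extChartAt 𝓘(ℝ, E) x p)) := by
  have h : ContinuousLinearMap.inverse (toChart (E := E) x p) = ofChart x p :=
    ContinuousLinearMap.inverse_eq (by ext u; exact toChart_ofChart hp u)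
      (by ext u; exact ofChart_toChart hp u)
  rw [← h, toChart_eq_mfderiv hp]
  rfl

lemma mlieBracket_eq_lieBracket (V W : Π z : E, TangentSpace 𝓘(ℝ, E) z) :
    mlieBracket 𝓘(ℝ, E) V W = lieBracket ℝ V W := by
  rw [← mlieBracketWithin_univ, mlieBracketWithin_eq_lieBracketWithin]
  exact lieBracketWithin_univ

/-- Near `p` both fields are pullbacks under the chart, and the Lie bracket commutes with pullbacks.
-/
lemma toChart_mlieBracket [CompleteSpace E] {A B : Π p : M, TangentSpace 𝓘(ℝ, E) p} {A' B' : E → E} {x p : M}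
    (hp : p ∈ (chartAt E x).source)
    (hA' : DifferentiableAt ℝ A' (extChartAt 𝓘(ℝ, E) x p))
    (hB' : DifferentiableAt ℝ B' (extChartAt 𝓘(ℝ, E) x p))
    (hA : ∀ᶠ q in 𝓝 p, toChart x q (A q) = A' (extChartAt 𝓘(ℝ, E) x q))
    (hB : ∀ᶠ q in 𝓝 p, toChart x q (B q) = B' (extChartAt 𝓘(ℝ, E) x q)) :
    toChart x p (mlieBracket 𝓘(ℝ, E) A B p)
      = fderiv ℝ B' (extChartAt 𝓘(ℝ, E) x p) (A' (extChartAt 𝓘(ℝ, E) x p))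
        - fderiv ℝ A' (extChartAt 𝓘(ℝ, E) x p) (B' (extChartAt 𝓘(ℝ, E) x p)) := by
  have key {A : Π p : M, TangentSpace 𝓘(ℝ, E) p} {A' : E → E}
      (hA : ∀ᶠ q in 𝓝 p, toChart x q (A q) = A' (extChartAt 𝓘(ℝ, E) x q)) :
      A =ᶠ[𝓝 p] mpullback 𝓘(ℝ, E) 𝓘(ℝ, E) (extChartAt 𝓘(ℝ, E) x) A' := by
    filter_upwards [hA, chart_source_mem_nhds hp] with q hq hq'
    rw [mpullback_extChartAt A' hq', ← hq, ofChart_toChart hq']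
  rw [(key hA).mlieBracket_vectorField_eq (key hB)]
  have : IsManifold 𝓘(ℝ, E) (minSmoothness ℝ 2) M := .of_le (n := ∞) (by
    rw [minSmoothness_of_isRCLikeNormedField]; exact two_le_infty)
  have h := mpullback_mlieBracket (I := 𝓘(ℝ, E)) (I' := 𝓘(ℝ, E)) (n := ∞)
    (f := extChartAt 𝓘(ℝ, E) x) (V := A') (W := B') (x₀ := p)
    (mdifferentiableAt_section_of_differentiableAt hA')
    (mdifferentiableAt_section_of_differentiableAt hB')
    (contMDiffAt_extChartAt' hp) (by
      rw [minSmoothness_of_isRCLikeNormedField]; exact two_le_infty)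
  have h' := mpullback_extChartAt (mlieBracket 𝓘(ℝ, E) (M := E) A' B') hp
  have hb := congrFun (mlieBracket_eq_lieBracket A' B') (extChartAt 𝓘(ℝ, E) x p)
  have h'' := congrArg (toChart (E := E) x p) (h.symm.trans h')
  exact (h''.trans (toChart_ofChart hp _)).trans hb

lemma localRep_vectorField_extChartAt (v : Π p : M, TangentSpace 𝓘(ℝ, E) p) {x p : M}
    (hp : p ∈ (chartAt E x).source) :
    localRep (E := E) E v x (extChartAt 𝓘(ℝ, E) x p) = toChart x p (v p) := by
  have hp' : p ∈ (extChartAt 𝓘(ℝ, E) x).source := by simpa using hp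
  rw [localRep_vectorField v x ((extChartAt 𝓘(ℝ, E) x).map_source hp'),
    (extChartAt 𝓘(ℝ, E) x).left_inv hp']

/-- The metric `g` in the chart at `x`. -/
def PseudoRiemannianMetric.localForm (g : PseudoRiemannianMetric E M) (x : M) :
    E → E →L[ℝ] E →L[ℝ] ℝ :=
  localRep (E := E) (E →L[ℝ] E →L[ℝ] ℝ)
    (V := fun p : M ↦ TangentSpace 𝓘(ℝ, E) p →L[ℝ] TangentSpace 𝓘(ℝ, E) p →L[ℝ] ℝ) g.val x

variable (g : PseudoRiemannianMetric E M)

lemma localForm_extChartAt {x p : M} (hp : p ∈ (chartAt E x).source) (u w : E) :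
    g.localForm x (extChartAt 𝓘(ℝ, E) x p) u w = g.val p (ofChart x p u) (ofChart x p w) := by
  have hp' : p ∈ (extChartAt 𝓘(ℝ, E) x).source := by simpa using hp
  rw [PseudoRiemannianMetric.localForm,
    localRep_bilinearForm g.val x ((extChartAt 𝓘(ℝ, E) x).map_source hp'),
    (extChartAt 𝓘(ℝ, E) x).left_inv hp']

lemma val_eq_localForm {x p : M} (hp : p ∈ (chartAt E x).source)
    (a b : TangentSpace 𝓘(ℝ, E) p) :
    g.val p a b = g.localForm x (extChartAt 𝓘(ℝ, E) x p) (toChart x p a) (toChart x p b) := by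
  rw [localForm_extChartAt g hp, ofChart_toChart hp, ofChart_toChart hp]

lemma contDiffAt_localForm (x : M) :
    ContDiffAt ℝ ∞ (g.localForm x) (extChartAt 𝓘(ℝ, E) x x) :=
  contDiffAt_localRep g.smooth.contMDiffAt

variable [FiniteDimensional ℝ E]

set_option maxHeartbeats 1000000 in
/-- The Levi-Civita connection in coordinates. -/
lemma nablaForm_ofChart {v : Π p : M, TangentSpace 𝓘(ℝ, E) p}
    (hv : ContMDiff 𝓘(ℝ, E) 𝓘(ℝ, E).tangent ∞ (T% v)) {x p : M}
    (hp : p ∈ (chartAt E x).source)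
    (hG : DifferentiableAt ℝ (g.localForm x) (extChartAt 𝓘(ℝ, E) x p))
    (hV : DifferentiableAt ℝ (localRep (E := E) E v x) (extChartAt 𝓘(ℝ, E) x p)) (u w : E) :
    g.nablaForm v hv p (ofChart x p u) (ofChart x p w)
      = g.localForm x (extChartAt 𝓘(ℝ, E) x p)
          (fderiv ℝ (localRep (E := E) E v x) (extChartAt 𝓘(ℝ, E) x p) u) w
        + 1 / 2 * (fderiv ℝ (g.localForm x) (extChartAt 𝓘(ℝ, E) x p) u (toChart x p (v p)) w
          + fderiv ℝ (g.localForm x) (extChartAt 𝓘(ℝ, E) x p) (toChart x p (v p)) u w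
          - fderiv ℝ (g.localForm x) (extChartAt 𝓘(ℝ, E) x p) w u (toChart x p (v p))) := by
  have : CompleteSpace E := FiniteDimensional.complete ℝ E
  rw [g.nablaForm_apply hv (mdifferentiableAt_ofChart hp u) (mdifferentiableAt_ofChart hp w)]
  set G := g.localForm x
  set V := localRep (E := E) E v x
  set z := extChartAt 𝓘(ℝ, E) x p
  have cst (e : E) : HasFDerivAt (fun _ : E ↦ e) (0 : E →L[ℝ] E) z := hasFDerivAt_const e z
  have evV : ∀ᶠ q in 𝓝 p, toChart x q (v q) = V (extChartAt 𝓘(ℝ, E) x q) := by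
    filter_upwards [chart_source_mem_nhds hp] with q hq
    exact (localRep_vectorField_extChartAt v hq).symm
  have evC (e : E) : ∀ᶠ q in 𝓝 p, toChart x q (ofChart x q e)
      = (fun _ : E ↦ e) (extChartAt 𝓘(ℝ, E) x q) := by
    filter_upwards [chart_source_mem_nhds hp] with q hq
    exact toChart_ofChart hq e
  have hVp : toChart x p (v p) = V z := evV.self_of_nhds
  obtain ⟨D₁, h1, e1⟩ := exists_hasFDerivAt_bilin hG.hasFDerivAt hV.hasFDerivAt (cst w)
  obtain ⟨D₂, h2, e2⟩ := exists_hasFDerivAt_bilin hG.hasFDerivAt (cst u) (cst w)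
  obtain ⟨D₃, h3, e3⟩ := exists_hasFDerivAt_bilin hG.hasFDerivAt (cst u) hV.hasFDerivAt
  have m1 := mvfderiv_eq_fderiv (f := fun q ↦ g.val q (v q) (ofChart x q w)) hp
    h1.differentiableAt (by
      filter_upwards [chart_source_mem_nhds hp, evV, evC w] with q hq hq1 hq2
      rw [val_eq_localForm g hq, hq1, hq2]) (ofChart x p u)
  have m2 := mvfderiv_eq_fderiv (f := fun q ↦ g.val q (ofChart x q u) (ofChart x q w)) hp
    h2.differentiableAt (by
      filter_upwards [chart_source_mem_nhds hp, evC u, evC w] with q hq hq1 hq2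
      rw [val_eq_localForm g hq, hq1, hq2]) (v p)
  have m3 := mvfderiv_eq_fderiv (f := fun q ↦ g.val q (ofChart x q u) (v q)) hp
    h3.differentiableAt (by
      filter_upwards [chart_source_mem_nhds hp, evC u, evV] with q hq hq1 hq2
      rw [val_eq_localForm g hq, hq1, hq2]) (ofChart x p w)
  have b1 := toChart_mlieBracket hp (cst u).differentiableAt hV (evC u) evV
  have b2 := toChart_mlieBracket hp (cst u).differentiableAt (cst w).differentiableAt
    (evC u) (evC w)
  have b3 := toChart_mlieBracket hp hV (cst w).differentiableAt evV (evC w)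
  rw [PseudoRiemannianMetric.koszul, m1, m2, m3, val_eq_localForm g hp (mlieBracket _ _ _ _),
    val_eq_localForm g hp (mlieBracket _ _ _ _), val_eq_localForm g hp (mlieBracket _ _ _ _),
    b1, b2, b3, h1.fderiv, h2.fderiv, h3.fderiv, e1, e2, e3, hVp, toChart_ofChart hp,
    toChart_ofChart hp, (cst u).fderiv, (cst w).fderiv]
  -- By symmetry the derivative of `v` along `w`, paired with `u`, cancels between the third
  -- derivative term and the bracket of `v` with the second coordinate field. The derivative along
  -- `u` occurs twice and absorbs the factor `1 / 2`.
  have hs (a b : E) : G z a b = G z b a := by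
    rw [localForm_extChartAt g hp, localForm_extChartAt g hp, g.symm]
  have hz : extChartAt 𝓘(ℝ, E) x p = z := rfl
  simp only [hz, zero_apply, map_zero, sub_zero, zero_sub, add_zero, map_neg, neg_apply,
    sub_self, hs u]
  ring

end CoordinateKoszul

/-! ### The jet of a conformal field at a zero, and its quintuple. -/

section JetOfConformalField

open Filter Topology

variable {E : Type*} [NormedAddCommGroup E] [NormedSpace ℝ E]
  {M : Type*} [TopologicalSpace M] [ChartedSpace E M] [IsManifold 𝓘(ℝ, E) ∞ M]
  (g : PseudoRiemannianMetric E M)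

lemma PseudoRiemannianMetric.ext_left {p : M} {a b : TangentSpace 𝓘(ℝ, E) p}
    (h : ∀ w, g.val p a w = g.val p b w) : a = b :=
  sub_eq_zero.1 (g.nondegenerate p _ fun w ↦ by rw [map_sub, sub_apply, h, sub_self])

lemma localForm_symm {x : M} {z : E} (hz : z ∈ (extChartAt 𝓘(ℝ, E) x).target) (u w : E) :
    g.localForm x z u w = g.localForm x z w u := by
  rw [PseudoRiemannianMetric.localForm, localRep_bilinearForm g.val x hz,
    localRep_bilinearForm g.val x hz, g.symm]

lemma localForm_self (x : M) (u w : E) :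
    g.localForm x (extChartAt 𝓘(ℝ, E) x x) u w = g.val x u w := by
  rw [localForm_extChartAt g (mem_chart_source E x), ofChart_self, ofChart_self]

lemma localForm_nondegenerate (x : M) (u : E)
    (hu : ∀ w, g.localForm x (extChartAt 𝓘(ℝ, E) x x) u w = 0) : u = 0 :=
  g.nondegenerate x u fun w ↦ (localForm_self g x u w).symm.trans (hu w)

lemma fderiv_localForm_symm {x : M} {a : E} (ha : a ∈ (extChartAt 𝓘(ℝ, E) x).target)
    (hG : DifferentiableAt ℝ (g.localForm x) a) (z u w : E) :
    fderiv ℝ (g.localForm x) a z u w = fderiv ℝ (g.localForm x) a z w u := by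
  have cst (e : E) : HasFDerivAt (fun _ : E ↦ e) (0 : E →L[ℝ] E) a := hasFDerivAt_const e _
  obtain ⟨D₁, h1, e1⟩ := exists_hasFDerivAt_bilin hG.hasFDerivAt (cst u) (cst w)
  obtain ⟨D₂, h2, e2⟩ := exists_hasFDerivAt_bilin hG.hasFDerivAt (cst w) (cst u)
  have hev : ∀ᶠ z in 𝓝 a, g.localForm x z u w = g.localForm x z w u := by
    filter_upwards [(isOpen_extChartAt_target x).mem_nhds ha] with z hz
    exact localForm_symm g hz u w
  have := DFunLike.congr_fun (h1.unique (h2.congr_of_eventuallyEq hev)) z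
  simpa [e1, e2] using this

variable [FiniteDimensional ℝ E] {g}

namespace ConformalVectorField

variable (v : ConformalVectorField g) (x : M)

/-- The field `v` in the chart at `x`. -/
def localField : E → E := localRep (E := E) E v.toFun x

/-- The function `φ` in the chart at `x`. -/
def localFactor (z : E) : ℝ := v.φ ((extChartAt 𝓘(ℝ, E) x).symm z)

lemma contDiffAt_localField : ContDiffAt ℝ ∞ (v.localField x) (extChartAt 𝓘(ℝ, E) x x) :=
  contDiffAt_localRep v.smooth.contMDiffAt

lemma contDiffAt_localFactor : ContDiffAt ℝ ∞ (v.localFactor x) (extChartAt 𝓘(ℝ, E) x x) :=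
  contDiffAt_comp_extChartAt_symm v.smooth_φ.contMDiffAt

lemma localFactor_extChartAt {x p : M} (hp : p ∈ (chartAt E x).source) :
    v.localFactor x (extChartAt 𝓘(ℝ, E) x p) = v.φ p := by
  rw [localFactor, (extChartAt 𝓘(ℝ, E) x).left_inv (by simpa using hp)]

lemma localField_self : v.localField x (extChartAt 𝓘(ℝ, E) x x) = v.toFun x :=
  (localRep_vectorField_extChartAt v.toFun (mem_chart_source E x)).trans (toChart_self x _)

variable {x} in
lemma localField_eq_zero (hx : v.toFun x = 0) :
    v.localField x (extChartAt 𝓘(ℝ, E) x x) = 0 :=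
  (v.localField_self x).trans hx

lemma nablaForm_eq (p : M) (u w : TangentSpace 𝓘(ℝ, E) p) :
    2 * g.nablaForm v.toFun v.smooth p u w = g.val p (v.A p u) w + v.φ p * g.val p u w := by
  have h := LinearMap.congr_fun (v.two_nabla p) u
  simp only [LinearMap.smul_apply, LinearMap.add_apply, LinearMap.id_apply] at h
  have h' := congrArg (fun e ↦ g.val p e w) h
  simpa [g.val_nabla] using h'

/-- Skewness of `A` removes it from the symmetric part of `∇v`. What remains is the equation `L_v g
= φ g`. -/
lemma nablaForm_add_nablaForm (p : M) (u w : TangentSpace 𝓘(ℝ, E) p) :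
    g.nablaForm v.toFun v.smooth p u w + g.nablaForm v.toFun v.smooth p w u
      = v.φ p * g.val p u w := by
  have h1 := v.nablaForm_eq p u w
  have h2 := v.nablaForm_eq p w u
  have h3 := v.skew p u w
  rw [g.symm p w u] at h2
  rw [g.symm p u (v.A p w)] at h3
  linarith

/-- Symmetrizing the coordinate formula for `∇v` leaves, of its three metric derivatives, only the
one along `v`. -/
lemma localField_killing : ∀ᶠ z in 𝓝 (extChartAt 𝓘(ℝ, E) x x), ∀ u w,
    g.localForm x z (fderiv ℝ (v.localField x) z u) w
      + g.localForm x z u (fderiv ℝ (v.localField x) z w)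
      + fderiv ℝ (g.localForm x) z (v.localField x z) u w
      = v.localFactor x z * g.localForm x z u w := by
  have h1 := ((contDiffAt_localForm g x).of_le (m := 1) (by simp)).eventually (by simp)
  have h2 := ((v.contDiffAt_localField x).of_le (m := 1) (by simp)).eventually (by simp)
  filter_upwards [extChartAt_target_mem_nhds_self x, h1, h2] with z hz hG hV u w
  replace hG := hG.differentiableAt (by simp)
  replace hV := hV.differentiableAt (by simp)
  obtain ⟨p, hp, rfl⟩ : ∃ p ∈ (chartAt E x).source, extChartAt 𝓘(ℝ, E) x p = z :=
    ⟨_, extChartAt_symm_mem_chart_source hz, (extChartAt 𝓘(ℝ, E) x).right_inv hz⟩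
  have k := v.nablaForm_add_nablaForm p (ofChart x p u) (ofChart x p w)
  rw [nablaForm_ofChart g v.smooth hp hG hV, nablaForm_ofChart g v.smooth hp hG hV,
    ← localForm_extChartAt g hp, ← localRep_vectorField_extChartAt v.toFun hp] at k
  rw [v.localFactor_extChartAt hp, ← k]
  have hs := localForm_symm g hz
  have hs' := fderiv_localForm_symm g hz hG (v.localField x (extChartAt 𝓘(ℝ, E) x p)) u w
  have hu := fderiv_localForm_symm g hz hG u w (v.localField x (extChartAt 𝓘(ℝ, E) x p))
  have hw := fderiv_localForm_symm g hz hG w u (v.localField x (extChartAt 𝓘(ℝ, E) x p))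
  rw [localField] at hs' hu hw ⊢
  rw [hs u]
  linarith

set_option synthInstance.maxHeartbeats 200000 in
/-- The metric, the conformal field and its factor `φ` in the chart at a zero `x` of the field, up
to the orders that enter the first derivative of the conformal equation. -/
def jet {x : M} (hx : v.toFun x = 0) : ConformalJet E where
  form := g.localForm x (extChartAt 𝓘(ℝ, E) x x)
  dform := fderiv ℝ (g.localForm x) (extChartAt 𝓘(ℝ, E) x x)
  lin := fderiv ℝ (v.localField x) (extChartAt 𝓘(ℝ, E) x x)
  quad := fderiv ℝ (fderiv ℝ (v.localField x)) (extChartAt 𝓘(ℝ, E) x x)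
  lam := v.φ x
  dlam := fderiv ℝ (v.localFactor x) (extChartAt 𝓘(ℝ, E) x x)
  form_symm := localForm_symm g (mem_extChartAt_target x)
  form_nondegenerate := localForm_nondegenerate g x
  dform_symm := fderiv_localForm_symm g (mem_extChartAt_target x)
    ((contDiffAt_localForm g x).differentiableAt (by simp))
  quad_symm := (((v.contDiffAt_localField x).of_le two_le_infty).isSymmSndFDerivAt (by simp))
  killing u w := by
    have h := (v.localField_killing x).self_of_nhds u w
    rw [v.localField_eq_zero hx, v.localFactor_extChartAt (mem_chart_source E x)] at h
    rw [← h, map_zero, zero_apply, zero_apply, add_zero]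
  dkilling z u w := by
    have h := killing_one_jet ((contDiffAt_localForm g x).of_le two_le_infty)
      ((v.contDiffAt_localField x).of_le two_le_infty)
      ((v.contDiffAt_localFactor x).differentiableAt (by simp))
      (v.localField_eq_zero hx) (v.localField_killing x) z u w
    rwa [v.localFactor_extChartAt (mem_chart_source E x)] at h

variable {x} (hx : v.toFun x = 0)

-- All metric derivatives in the formula for `∇v` are multiplied by `v`, so at a zero `∇v` is the
-- ordinary derivative.
set_option synthInstance.maxHeartbeats 200000 in
lemma nabla_eq_jet_lin (u : E) : g.nabla v.toFun v.smooth x u = (v.jet hx).lin u := by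
  refine g.ext_left fun (w : E) ↦ ?_
  have h := nablaForm_ofChart g v.smooth (mem_chart_source E x)
    ((contDiffAt_localForm g x).differentiableAt (by simp))
    ((v.contDiffAt_localField x).differentiableAt (by simp)) u w
  have h0 : toChart x x (v.toFun x) = 0 := by rw [hx, map_zero]
  simp only [h0, map_zero, zero_apply, add_zero, sub_zero, mul_zero] at h
  exact (g.val_nabla v.smooth x u w).trans
    (((congrArg₂ (fun a b ↦ g.nablaForm v.toFun v.smooth x a b) (ofChart_self (E := E) x u)
      (ofChart_self (E := E) x w)).symm.trans h).trans (localForm_self g x _ _))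

lemma quintuple_B_eq (u : E) :
    (v.quintuple x).B u = (2 : ℝ) • (v.jet hx).lin u - (v.jet hx).lam • u := by
  have h := LinearMap.congr_fun (v.two_nabla x) u
  have h1 : (2 : ℝ) • (v.jet hx).lin u = (show E from v.A x u) + v.φ x • u :=
    (congrArg (fun e : E ↦ (2 : ℝ) • e) (v.nabla_eq_jet_lin hx u)).symm.trans h
  rw [h1]
  exact (add_sub_cancel_right _ _).symm

/-- `B + λ` is twice the linear part of the field. -/
lemma mem_ker_quintuple_iff (u : E) :
    u ∈ LinearMap.ker ((v.quintuple x).B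
      + (v.quintuple x).lam • (LinearMap.id : TangentSpace 𝓘(ℝ, E) x →ₗ[ℝ] _)) ↔
      (v.jet hx).lin u = 0 := by
  have h : ((v.quintuple x).B + (v.quintuple x).lam •
      (LinearMap.id : TangentSpace 𝓘(ℝ, E) x →ₗ[ℝ] _)) u = (2 : ℝ) • (v.jet hx).lin u :=
    (congrArg (fun e : E ↦ e + (v.jet hx).lam • u) (v.quintuple_B_eq hx u)).trans
      (sub_add_cancel _ _)
  constructor <;> intro e
  · have e' : (2 : ℝ) • (v.jet hx).lin u = 0 := h.symm.trans e
    simpa using e'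
  · have e' : (2 : ℝ) • (v.jet hx).lin u = 0 := by simp [e]
    exact h.trans e'

lemma quintuple_δ_eq (u : LinearMap.ker ((v.quintuple x).B
      + (v.quintuple x).lam • (LinearMap.id : TangentSpace 𝓘(ℝ, E) x →ₗ[ℝ] _))) :
    (v.quintuple x).δ u = (v.jet hx).dlam (u : TangentSpace 𝓘(ℝ, E) x) := by
  have h := mvfderiv_eq_fderiv (f := v.φ) (f' := v.localFactor x) (mem_chart_source E x)
    ((v.contDiffAt_localFactor x).differentiableAt (by simp))
    (by filter_upwards [chart_source_mem_nhds (mem_chart_source E x)] with q hq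
        exact (v.localFactor_extChartAt hq).symm) u
  exact h.trans (congrArg _ (toChart_self x _))

end ConformalVectorField

end JetOfConformalField

/-! ### Algebraic equivalence of quintuples in terms of jets. -/

section QuintupleEquivalence

/-- The hypotheses say that `C` is a subgroup of the nonzero reals. Homothety classes are then
orbits of `C`, and matching one representative up to a factor in `C` matches the classes. -/
lemma Quintuple.algebraicallyEquivalent_iff {C : Set ℝ} (h0 : 0 ∉ C) (h1 : 1 ∈ C)
    (hmul : ∀ a ∈ C, ∀ b ∈ C, a * b ∈ C) (hinv : ∀ a ∈ C, a⁻¹ ∈ C)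
    {T T' : Type*} [AddCommGroup T] [Module ℝ T] [AddCommGroup T'] [Module ℝ T']
    (Q : Quintuple T) (Q' : Quintuple T') :
    Q.AlgebraicallyEquivalent C Q' ↔ Q'.lam = Q.lam ∧ ∃ L : T ≃ₗ[ℝ] T',
      (∃ c ∈ C, ∀ u w, Q'.η (L u) (L w) = c * Q.η u w) ∧
      (∀ u, L (Q.B u) = Q'.B (L u)) ∧
      ∀ (u : T) (hu : u ∈ LinearMap.ker (Q.B + Q.lam • (LinearMap.id : T →ₗ[ℝ] T)))
        (hu' : L u ∈ LinearMap.ker (Q'.B + Q'.lam • (LinearMap.id : T' →ₗ[ℝ] T'))),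
        Q'.δ ⟨L u, hu'⟩ = Q.δ ⟨u, hu⟩ := by
  refine and_congr_right fun _ ↦ exists_congr fun L ↦ and_congr_left fun _ ↦ ⟨fun h ↦ ?_, ?_⟩
  · have : Q'.η ∈ homothetyClass C Q'.η := ⟨1, h1, (one_smul ℝ _).symm⟩
    rw [← h] at this
    obtain ⟨_, ⟨c, hc, rfl⟩, hβ⟩ := this
    refine ⟨c, hc, fun u w ↦ ?_⟩
    rw [← hβ]
    simp
  · rintro ⟨c, hc, hcη⟩
    have hc0 : c ≠ 0 := fun h ↦ h0 (h ▸ hc)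
    ext β
    constructor
    · rintro ⟨_, ⟨d, hd, rfl⟩, rfl⟩
      refine ⟨d * c⁻¹, hmul _ hd _ (hinv _ hc), ?_⟩
      ext u w
      have := hcη (L.symm u) (L.symm w)
      simp only [LinearEquiv.apply_symm_apply] at this
      simp [this, mul_assoc, hc0]
    · rintro ⟨d, hd, rfl⟩
      refine ⟨_, ⟨d * c, hmul _ hd _ hc, rfl⟩, ?_⟩
      ext u w
      have := hcη (L.symm u) (L.symm w)
      simp only [LinearEquiv.apply_symm_apply] at this
      simp [this, mul_assoc]

variable {E : Type*} [NormedAddCommGroup E] [NormedSpace ℝ E] [FiniteDimensional ℝ E]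
  {M : Type*} [TopologicalSpace M] [ChartedSpace E M] [IsManifold 𝓘(ℝ, E) ∞ M]
  {E' : Type*} [NormedAddCommGroup E'] [NormedSpace ℝ E'] [FiniteDimensional ℝ E']
  {N : Type*} [TopologicalSpace N] [ChartedSpace E' N] [IsManifold 𝓘(ℝ, E') ∞ N]
  {g : PseudoRiemannianMetric E M} {v : ConformalVectorField g} {x : M} (hx : v.toFun x = 0)
  {h : PseudoRiemannianMetric E' N} {w : ConformalVectorField h} {y : N} (hy : w.toFun y = 0)

lemma quintuple_algebraicallyEquivalent_iff {C : Set ℝ} (h0 : 0 ∉ C) (h1 : 1 ∈ C)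
    (hmul : ∀ a ∈ C, ∀ b ∈ C, a * b ∈ C) (hinv : ∀ a ∈ C, a⁻¹ ∈ C) :
    (v.quintuple x).AlgebraicallyEquivalent C (w.quintuple y) ↔
      (w.jet hy).lam = (v.jet hx).lam ∧ ∃ L : E ≃L[ℝ] E',
        (∃ c ∈ C, ∀ u₁ u₂, (w.jet hy).form (L u₁) (L u₂) = c * (v.jet hx).form u₁ u₂) ∧
        (∀ u, L ((v.jet hx).lin u) = (w.jet hy).lin (L u)) ∧
        ∀ z, (v.jet hx).lin z = 0 → (w.jet hy).dlam (L z) = (v.jet hx).dlam z := by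
  rw [Quintuple.algebraicallyEquivalent_iff h0 h1 hmul hinv]
  have hB := v.quintuple_B_eq hx
  have hB' := w.quintuple_B_eq hy
  have hη (u₁ u₂ : E) : (v.quintuple x).η u₁ u₂ = (v.jet hx).form u₁ u₂ :=
    (localForm_self g x u₁ u₂).symm
  have hη' (u₁ u₂ : E') : (w.quintuple y).η u₁ u₂ = (w.jet hy).form u₁ u₂ :=
    (localForm_self h y u₁ u₂).symm
  refine and_congr_right fun (hlam : (w.jet hy).lam = (v.jet hx).lam) ↦ ⟨?_, ?_⟩
  · rintro ⟨L₀, ⟨c, hc, hform⟩, hcomm, hδ⟩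
    let L₁ : E ≃ₗ[ℝ] E' := L₀
    let L : E ≃L[ℝ] E' := L₁.toContinuousLinearEquiv
    have hlin (u : E) : L ((v.jet hx).lin u) = (w.jet hy).lin (L u) := by
      have e : L ((2 : ℝ) • (v.jet hx).lin u - (v.jet hx).lam • u)
          = (2 : ℝ) • (w.jet hy).lin (L u) - (w.jet hy).lam • L u :=
        (congrArg L (hB u)).symm.trans ((hcomm u).trans (hB' (L u)))
      rw [map_sub, map_smul, map_smul, hlam, sub_left_inj] at e
      exact smul_right_injective E' (two_ne_zero' ℝ) e
    refine ⟨L, ⟨c, hc, fun u₁ u₂ ↦ ?_⟩, hlin, fun z hz ↦ ?_⟩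
    · exact (hη' (L u₁) (L u₂)).symm.trans ((hform u₁ u₂).trans (congrArg (c * ·) (hη u₁ u₂)))
    · have hu := (v.mem_ker_quintuple_iff hx z).2 hz
      -- Membership of the image in the second kernel is automatic, since `L` intertwines the linear
      -- parts.
      have hu' := (w.mem_ker_quintuple_iff hy (L z)).2 (by rw [← hlin, hz, map_zero])
      exact (w.quintuple_δ_eq hy ⟨L z, hu'⟩).symm.trans
        ((hδ z hu hu').trans (v.quintuple_δ_eq hx ⟨z, hu⟩))
  · rintro ⟨L, ⟨c, hc, hform⟩, hlin, hdlam⟩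
    let L₀ : TangentSpace 𝓘(ℝ, E) x ≃ₗ[ℝ] TangentSpace 𝓘(ℝ, E') y := L.toLinearEquiv
    refine ⟨L₀, ⟨c, hc, fun u₁ u₂ ↦ ?_⟩, fun (u : E) ↦ ?_, fun u hu hu' ↦ ?_⟩
    · exact (hη' (L u₁) (L u₂)).trans ((hform u₁ u₂).trans (congrArg (c * ·) (hη u₁ u₂).symm))
    · refine (congrArg L (hB u)).trans (Eq.trans ?_ (hB' (L u)).symm)
      rw [map_sub, map_smul, map_smul, hlam, hlin]
    · exact (w.quintuple_δ_eq hy ⟨L u, hu'⟩).trans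
        ((hdlam u ((v.mem_ker_quintuple_iff hx u).1 hu)).trans (v.quintuple_δ_eq hx ⟨u, hu⟩).symm)

end QuintupleEquivalence

/-! ### Push-forward and pullback by a local diffeomorphism, in coordinates. -/

section LocalDiffeomorphism

open Filter Topology

variable {E : Type*} [NormedAddCommGroup E] [NormedSpace ℝ E]
  {M : Type*} [TopologicalSpace M] [ChartedSpace E M]
  {E' : Type*} [NormedAddCommGroup E'] [NormedSpace ℝ E']
  {N : Type*} [TopologicalSpace N] [ChartedSpace E' N]

/-- A map in the charts at `x` and `y`. -/
def localMap (F : M → N) (x : M) (y : N) (z : E) : E' :=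
  extChartAt 𝓘(ℝ, E') y (F ((extChartAt 𝓘(ℝ, E) x).symm z))

lemma localMap_extChartAt (F : M → N) {x p : M} (y : N) (hp : p ∈ (chartAt E x).source) :
    localMap (E := E) (E' := E') F x y (extChartAt 𝓘(ℝ, E) x p) = extChartAt 𝓘(ℝ, E') y (F p) := by
  rw [localMap, (extChartAt 𝓘(ℝ, E) x).left_inv (by simpa using hp)]

lemma localMap_self (F : M → N) (x : M) :
    localMap (E := E) (E' := E') F x (F x) (extChartAt 𝓘(ℝ, E) x x)
      = extChartAt 𝓘(ℝ, E') (F x) (F x) :=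
  localMap_extChartAt F (F x) (mem_chart_source E x)

lemma eventually_nhds_extChartAt {P : E → Prop} {x : M}
    (h : ∀ᶠ p in 𝓝 x, P (extChartAt 𝓘(ℝ, E) x p)) : ∀ᶠ z in 𝓝 (extChartAt 𝓘(ℝ, E) x x), P z := by
  have hc := (continuousAt_extChartAt_symm (I := 𝓘(ℝ, E)) x).tendsto
  rw [extChartAt_to_inv] at hc
  filter_upwards [hc.eventually h, extChartAt_target_mem_nhds_self x] with z h1 h2
  rwa [(extChartAt 𝓘(ℝ, E) x).right_inv h2] at h1

variable [IsManifold 𝓘(ℝ, E) ∞ M] [IsManifold 𝓘(ℝ, E') ∞ N]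

omit [IsManifold 𝓘(ℝ, E) ∞ M] [IsManifold 𝓘(ℝ, E') ∞ N] in
lemma contDiffAt_localMap {F : M → N} {x : M} (hF : ContMDiffAt 𝓘(ℝ, E) 𝓘(ℝ, E') ∞ F x) :
    ContDiffAt ℝ ∞ (localMap (E := E) (E' := E') F x (F x)) (extChartAt 𝓘(ℝ, E) x x) := by
  have h := (contMDiffAt_iff.1 hF).2
  rw [ModelWithCorners.range_eq_univ, contDiffWithinAt_univ] at h
  exact h

lemma toChart_mfderiv {F : M → N} {x p : M} {y : N} (hp : p ∈ (chartAt E x).source)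
    (hFp : F p ∈ (chartAt E' y).source) (hF : MDifferentiableAt 𝓘(ℝ, E) 𝓘(ℝ, E') F p)
    (hψ : DifferentiableAt ℝ (localMap (E := E) (E' := E') F x y) (extChartAt 𝓘(ℝ, E) x p))
    (u : TangentSpace 𝓘(ℝ, E) p) :
    toChart y (F p) (mfderiv 𝓘(ℝ, E) 𝓘(ℝ, E') F p u)
      = fderiv ℝ (localMap (E := E) (E' := E') F x y) (extChartAt 𝓘(ℝ, E) x p)
        (toChart x p u) := by
  have h1 : mfderiv 𝓘(ℝ, E) 𝓘(ℝ, E') (extChartAt 𝓘(ℝ, E') y ∘ F) p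
      = (toChart (E := E') y (F p)).comp (mfderiv 𝓘(ℝ, E) 𝓘(ℝ, E') F p) := by
    rw [toChart_eq_mfderiv hFp, mfderiv_comp p (mdifferentiableAt_extChartAt hFp) hF]
    rfl
  have h2 : mfderiv 𝓘(ℝ, E) 𝓘(ℝ, E') (localMap (E := E) (E' := E') F x y ∘ extChartAt 𝓘(ℝ, E) x) p
      = (fderiv ℝ (localMap (E := E) (E' := E') F x y) (extChartAt 𝓘(ℝ, E) x p)).comp
        (toChart (E := E) x p) := by
    rw [toChart_eq_mfderiv hp, mfderiv_comp p hψ.mdifferentiableAt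
      (mdifferentiableAt_extChartAt hp), mfderiv_eq_fderiv]
    rfl
  have h3 : (extChartAt 𝓘(ℝ, E') y ∘ F)
      =ᶠ[𝓝 p] (localMap (E := E) (E' := E') F x y ∘ extChartAt 𝓘(ℝ, E) x) := by
    filter_upwards [chart_source_mem_nhds hp] with q hq
    exact (localMap_extChartAt F y hq).symm
  exact DFunLike.congr_fun (h1.symm.trans ((h3.mfderiv_eq).trans h2)) u

/-- `F` restricts to a diffeomorphism from its source onto its target. -/
structure IsSmoothDiffeo (F : OpenPartialHomeomorph M N) : Prop where
  contMDiffOn : ContMDiffOn 𝓘(ℝ, E) 𝓘(ℝ, E') ∞ F F.source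
  contMDiffOn_symm : ContMDiffOn 𝓘(ℝ, E') 𝓘(ℝ, E) ∞ F.symm F.target

namespace IsSmoothDiffeo

variable {F : OpenPartialHomeomorph M N} (hF : IsSmoothDiffeo (E := E) (E' := E') F)
  {x : M} (hx : x ∈ F.source)

omit [IsManifold 𝓘(ℝ, E) ∞ M] [IsManifold 𝓘(ℝ, E') ∞ N] in
include hF in
lemma symm : IsSmoothDiffeo (E := E') (E' := E) F.symm :=
  ⟨hF.contMDiffOn_symm, hF.contMDiffOn⟩

omit [IsManifold 𝓘(ℝ, E) ∞ M] [IsManifold 𝓘(ℝ, E') ∞ N] in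
include hF in
lemma contMDiffAt (hx : x ∈ F.source) : ContMDiffAt 𝓘(ℝ, E) 𝓘(ℝ, E') ∞ F x :=
  hF.contMDiffOn.contMDiffAt (F.open_source.mem_nhds hx)

omit [IsManifold 𝓘(ℝ, E) ∞ M] [IsManifold 𝓘(ℝ, E') ∞ N] in
include hF in
lemma mDifferentiable : F.MDifferentiable 𝓘(ℝ, E) 𝓘(ℝ, E') :=
  ⟨hF.contMDiffOn.mdifferentiableOn (by simp), hF.contMDiffOn_symm.mdifferentiableOn (by simp)⟩

include hF in
lemma eventually_toChart_mfderiv (hx : x ∈ F.source) : ∀ᶠ p in 𝓝 x,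
    p ∈ (chartAt E x).source ∧ F p ∈ (chartAt E' (F x)).source ∧ p ∈ F.source ∧
    ∀ u : TangentSpace 𝓘(ℝ, E) p,
      toChart (F x) (F p) (mfderiv 𝓘(ℝ, E) 𝓘(ℝ, E') F p u)
        = fderiv ℝ (localMap (E := E) (E' := E') F x (F x)) (extChartAt 𝓘(ℝ, E) x p)
          (toChart x p u) := by
  have h1 := F.open_source.mem_nhds hx
  have h2 := chart_source_mem_nhds (mem_chart_source E x)
  have h3 := (F.continuousAt hx).eventually
    (chart_source_mem_nhds (mem_chart_source E' (F x)))
  have h4 := (continuousAt_extChartAt (I := 𝓘(ℝ, E)) x).eventually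
    (((contDiffAt_localMap (hF.contMDiffAt hx)).of_le (m := 1) (by simp)).eventually (by simp))
  filter_upwards [h1, h2, h3, h4] with p h1 h2 h3 h4
  exact ⟨h2, h3, h1, fun u ↦ toChart_mfderiv h2 h3 (hF.mDifferentiable.mdifferentiableAt h1)
    (h4.differentiableAt (by simp)) u⟩

omit [IsManifold 𝓘(ℝ, E) ∞ M] [IsManifold 𝓘(ℝ, E') ∞ N] in
include hF in
lemma mpullback_symm (v : Π p : M, TangentSpace 𝓘(ℝ, E) p) {p : M} (hp : p ∈ F.source) :
    mpullback 𝓘(ℝ, E') 𝓘(ℝ, E) F.symm v (F p) = mfderiv 𝓘(ℝ, E) 𝓘(ℝ, E') F p (v p) := by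
  have h1 := hF.mDifferentiable.symm_comp_deriv hp
  have h2 := hF.mDifferentiable.comp_symm_deriv (F.map_source hp)
  rw [mpullback_apply]
  rw [F.left_inv hp] at h2 ⊢
  rw [ContinuousLinearMap.inverse_eq h1 h2]

include hF in
/-- The push-forward of a vector field in coordinates. -/
lemma localRep_mpullback_symm (v : Π p : M, TangentSpace 𝓘(ℝ, E) p) (hx : x ∈ F.source) :
    ∀ᶠ z in 𝓝 (extChartAt 𝓘(ℝ, E) x x),
      localRep (E := E') E' (mpullback 𝓘(ℝ, E') 𝓘(ℝ, E) F.symm v) (F x)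
        (localMap (E := E) (E' := E') F x (F x) z)
      = fderiv ℝ (localMap (E := E) (E' := E') F x (F x)) z (localRep (E := E) E v x z) := by
  refine eventually_nhds_extChartAt ?_
  filter_upwards [hF.eventually_toChart_mfderiv hx] with p ⟨h1, h2, h3, h4⟩
  rw [localMap_extChartAt F _ h1, localRep_vectorField_extChartAt _ h2,
    localRep_vectorField_extChartAt _ h1, ← h4, hF.mpullback_symm v h3]

include hF in
/-- The pullback of a metric in coordinates. -/
lemma localRep_pullbackForm (h : PseudoRiemannianMetric E' N) (hx : x ∈ F.source) :
    ∀ᶠ z in 𝓝 (extChartAt 𝓘(ℝ, E) x x), ∀ u w,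
      localRep (E := E) (E →L[ℝ] E →L[ℝ] ℝ)
        (V := fun p : M ↦ TangentSpace 𝓘(ℝ, E) p →L[ℝ] TangentSpace 𝓘(ℝ, E) p →L[ℝ] ℝ)
        (pullbackForm F h.val) x z u w
      = h.localForm (F x) (localMap (E := E) (E' := E') F x (F x) z)
        (fderiv ℝ (localMap (E := E) (E' := E') F x (F x)) z u)
        (fderiv ℝ (localMap (E := E) (E' := E') F x (F x)) z w) := by
  refine eventually_nhds_extChartAt ?_
  filter_upwards [hF.eventually_toChart_mfderiv hx] with p ⟨h1, h2, h3, h4⟩ u w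
  have hp' : p ∈ (extChartAt 𝓘(ℝ, E) x).source := by simpa using h1
  rw [localRep_bilinearForm _ x ((extChartAt 𝓘(ℝ, E) x).map_source hp'),
    (extChartAt 𝓘(ℝ, E) x).left_inv hp', localMap_extChartAt F _ h1]
  have e (u : E) := (h4 (ofChart x p u)).trans (congrArg _ (toChart_ofChart h1 u))
  exact (val_eq_localForm h h2 _ _).trans
    (congrArg₂ (fun a b ↦ h.localForm (F x) (extChartAt 𝓘(ℝ, E') (F x) (F p)) a b) (e u) (e w))

include hF in
lemma localMap_symm_localMap (hx : x ∈ F.source) : ∀ᶠ z in 𝓝 (extChartAt 𝓘(ℝ, E) x x),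
    localMap (E := E') (E' := E) F.symm (F x) x (localMap (E := E) (E' := E') F x (F x) z) = z := by
  refine eventually_nhds_extChartAt ?_
  filter_upwards [hF.eventually_toChart_mfderiv hx] with p ⟨h1, h2, h3, h4⟩
  rw [localMap_extChartAt F _ h1, localMap_extChartAt F.symm _ h2, F.left_inv h3]

end IsSmoothDiffeo

end LocalDiffeomorphism

/-! ### Agreement of jets as algebraic conditions on derivatives. -/

section JetsOfLocalDiffeomorphism

open Filter Topology

variable {E : Type*} [NormedAddCommGroup E] [NormedSpace ℝ E]
  {M : Type*} [TopologicalSpace M] [ChartedSpace E M] [IsManifold 𝓘(ℝ, E) ∞ M]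
  {E' : Type*} [NormedAddCommGroup E'] [NormedSpace ℝ E']
  {N : Type*} [TopologicalSpace N] [ChartedSpace E' N] [IsManifold 𝓘(ℝ, E') ∞ N]

lemma differentiableAt_clm_apply {X Y : Type*} [NormedAddCommGroup X] [NormedSpace ℝ X]
    [NormedAddCommGroup Y] [NormedSpace ℝ Y] (T : X →L[ℝ] Y) {f : E → X} {a : E}
    (hf : DifferentiableAt ℝ f a) : DifferentiableAt ℝ (fun z ↦ T (f z)) a :=
  T.differentiableAt.comp a hf

set_option synthInstance.maxHeartbeats 200000 in
lemma differentiableAt_clm_flip {F G W : Type*} [NormedAddCommGroup F] [NormedSpace ℝ F]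
    [NormedAddCommGroup G] [NormedSpace ℝ G] [NormedAddCommGroup W] [NormedSpace ℝ W]
    {f : E → F →L[ℝ] G →L[ℝ] W} {a : E} (hf : DifferentiableAt ℝ f a) :
    DifferentiableAt ℝ (fun z ↦ (f z).flip) a :=
  differentiableAt_clm_apply (X := F →L[ℝ] G →L[ℝ] W) (Y := G →L[ℝ] F →L[ℝ] W)
    (ContinuousLinearMap.flipₗᵢ ℝ F G W).toContinuousLinearEquiv.toContinuousLinearMap hf

lemma differentiableAt_bilinearComp {F G W : Type*} [NormedAddCommGroup F] [NormedSpace ℝ F]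
    [NormedAddCommGroup G] [NormedSpace ℝ G] [NormedAddCommGroup W] [NormedSpace ℝ W]
    {B : E → F →L[ℝ] F →L[ℝ] W} {A : E → G →L[ℝ] F} {a : E}
    (hB : DifferentiableAt ℝ B a) (hA : DifferentiableAt ℝ A a) :
    DifferentiableAt ℝ (fun z ↦ (B z).bilinearComp (A z) (A z)) a :=
  differentiableAt_clm_flip ((differentiableAt_clm_flip (hB.clm_comp hA)).clm_comp hA)

namespace IsSmoothDiffeo

variable {F : OpenPartialHomeomorph M N} {x : M}

/-- The derivative at `x` of a diffeomorphism in coordinates. -/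
lemma exists_equiv_fderiv_localMap (hF : IsSmoothDiffeo (E := E) (E' := E') F)
    (hx : x ∈ F.source) : ∃ L : E ≃L[ℝ] E',
      (L : E →L[ℝ] E')
        = fderiv ℝ (localMap (E := E) (E' := E') F x (F x)) (extChartAt 𝓘(ℝ, E) x x) := by
  have hx' : F x ∈ F.symm.source := F.map_source hx
  have h1 := (contDiffAt_localMap (hF.contMDiffAt hx)).differentiableAt (by simp)
  have h2 := (contDiffAt_localMap (hF.symm.contMDiffAt hx')).differentiableAt (by simp)
  have h3 := hF.localMap_symm_localMap hx
  have h4 := hF.symm.localMap_symm_localMap hx'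
  rw [F.left_inv hx] at h2 h4
  rw [← localMap_self (E := E) (E' := E') F x] at h2
  have e1 := (h2.hasFDerivAt.comp _ h1.hasFDerivAt).unique
    ((hasFDerivAt_id _).congr_of_eventuallyEq h3)
  rw [localMap_self] at h2 e1
  have hs : localMap (E := E') (E' := E) F.symm (F x) x (extChartAt 𝓘(ℝ, E') (F x) (F x))
      = extChartAt 𝓘(ℝ, E) x x := by
    have := localMap_self (E := E') (E' := E) F.symm (F x)
    rwa [F.left_inv hx] at this
  rw [← hs] at h1
  have e2 := (h1.hasFDerivAt.comp _ h2.hasFDerivAt).unique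
    ((hasFDerivAt_id _).congr_of_eventuallyEq h4)
  rw [hs] at e2
  exact ⟨ContinuousLinearEquiv.equivOfInverse' _ _ e2 e1, rfl⟩

/-- In coordinates the push-forward is the derivative of the map applied to the field, composed with
the inverse map; each factor is smooth. -/
lemma contDiffAt_localRep_mpullback_symm (hF : IsSmoothDiffeo (E := E) (E' := E') F)
    (hx : x ∈ F.source) {v : Π p : M, TangentSpace 𝓘(ℝ, E) p}
    (hv : ContDiffAt ℝ ∞ (localRep (E := E) E v x) (extChartAt 𝓘(ℝ, E) x x)) :
    ContDiffAt ℝ ∞ (localRep (E := E') E' (mpullback 𝓘(ℝ, E') 𝓘(ℝ, E) F.symm v) (F x))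
      (extChartAt 𝓘(ℝ, E') (F x) (F x)) := by
  have hx' : F x ∈ F.symm.source := F.map_source hx
  have h1 := contDiffAt_localMap (hF.contMDiffAt hx)
  have h2 := contDiffAt_localMap (hF.symm.contMDiffAt hx')
  have h4 := hF.symm.localMap_symm_localMap hx'
  have hs := localMap_self (E := E') (E' := E) F.symm (F x)
  rw [F.left_inv hx] at h2 h4 hs
  have h5 := (h2.continuousAt.tendsto.eventually
    (by rw [hs]; exact hF.localRep_mpullback_symm v hx))
  have h6 : ContDiffAt ℝ ∞ (fun z ↦
      fderiv ℝ (localMap (E := E) (E' := E') F x (F x))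
        (localMap (E := E') (E' := E) F.symm (F x) x z)
        (localRep (E := E) E v x (localMap (E := E') (E' := E) F.symm (F x) x z)))
      (extChartAt 𝓘(ℝ, E') (F x) (F x)) := by
    rw [← hs] at h1 hv
    exact ((h1.fderiv_right (m := ∞) (by simp)).comp _ h2).clm_apply (hv.comp _ h2)
  refine h6.congr_of_eventuallyEq ?_
  filter_upwards [h4, h5] with z e1 e2
  rw [← e2]
  exact congrArg _ e1.symm

/-- Agreement of `2`-jets of vector fields in terms of derivatives in coordinates. -/
lemma sameJet_two_iff (hF : IsSmoothDiffeo (E := E) (E' := E') F)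
    (hx : x ∈ F.source) {v : Π p : M, TangentSpace 𝓘(ℝ, E) p}
    (hv : ContDiffAt ℝ ∞ (localRep (E := E) E v x) (extChartAt 𝓘(ℝ, E) x x))
    (hvx : localRep (E := E) E v x (extChartAt 𝓘(ℝ, E) x x) = 0)
    {w : Π q : N, TangentSpace 𝓘(ℝ, E') q}
    (hwy : localRep (E := E') E' w (F x) (extChartAt 𝓘(ℝ, E') (F x) (F x)) = 0) :
    SameJet (E := E') 2 E' (mpullback 𝓘(ℝ, E') 𝓘(ℝ, E) F.symm v) w (F x) ↔
      MapsVectorJet (fderiv ℝ (localMap (E := E) (E' := E') F x (F x)) (extChartAt 𝓘(ℝ, E) x x))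
        (fderiv ℝ (fderiv ℝ (localMap (E := E) (E' := E') F x (F x))) (extChartAt 𝓘(ℝ, E) x x))
        (fderiv ℝ (localRep (E := E) E v x) (extChartAt 𝓘(ℝ, E) x x))
        (fderiv ℝ (fderiv ℝ (localRep (E := E) E v x)) (extChartAt 𝓘(ℝ, E) x x))
        (fderiv ℝ (localRep (E := E') E' w (F x)) (extChartAt 𝓘(ℝ, E') (F x) (F x)))
        (fderiv ℝ (fderiv ℝ (localRep (E := E') E' w (F x)))
          (extChartAt 𝓘(ℝ, E') (F x) (F x))) := by
  obtain ⟨L, hL⟩ := hF.exists_equiv_fderiv_localMap hx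
  have hψ := contDiffAt_localMap (hF.contMDiffAt hx)
  have hs := localMap_self (E := E) (E' := E') F x
  have hX := hF.contDiffAt_localRep_mpullback_symm hx hv
  have hev := hF.localRep_mpullback_symm v hx
  -- The jet of the push-forward always satisfies the transport relations, so agreement with the jet
  -- of `w` becomes the same relations for `w`.
  have key := mapsVectorJet_of_eventuallyEq (hψ.of_le (by exact WithTop.coe_le_coe.2 le_top))
    (hv.of_le two_le_infty) (by rw [hs]; exact hX.of_le two_le_infty) hvx hev
  have h0 := hev.self_of_nhds
  rw [hs, hvx, map_zero] at h0
  rw [hs] at key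
  rw [SameJet, iteratedFDeriv_le_two_eq_iff]
  constructor
  · rintro ⟨-, h1, h2⟩
    rwa [h1, h2] at key
  · intro hw
    rw [← hL] at hw key
    obtain ⟨h1, h2⟩ := ext_of_mapsVectorJet L key hw
    exact ⟨h0.trans hwy.symm, h1, h2⟩

set_option synthInstance.maxHeartbeats 200000 in
/-- Agreement of `1`-jets of metrics in terms of derivatives in coordinates. -/
lemma sameJet_one_iff (hF : IsSmoothDiffeo (E := E) (E' := E') F) (hx : x ∈ F.source)
    (g : PseudoRiemannianMetric E M) (h : PseudoRiemannianMetric E' N) {τ : M → ℝ}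
    (hτ : ContMDiffAt 𝓘(ℝ, E) 𝓘(ℝ, ℝ) ∞ τ x) :
    SameJet (E := E) 1 (E →L[ℝ] E →L[ℝ] ℝ)
      (V := fun p : M ↦ TangentSpace 𝓘(ℝ, E) p →L[ℝ] TangentSpace 𝓘(ℝ, E) p →L[ℝ] ℝ)
      (pullbackForm F h.val) (fun p ↦ Real.exp (τ p) • g.val p) x ↔
    PullsMetricJet (fderiv ℝ (localMap (E := E) (E' := E') F x (F x)) (extChartAt 𝓘(ℝ, E) x x))
      (fderiv ℝ (fderiv ℝ (localMap (E := E) (E' := E') F x (F x))) (extChartAt 𝓘(ℝ, E) x x))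
      (Real.exp (τ x))
      (fderiv ℝ (fun z ↦ τ ((extChartAt 𝓘(ℝ, E) x).symm z)) (extChartAt 𝓘(ℝ, E) x x))
      (g.localForm x (extChartAt 𝓘(ℝ, E) x x))
      (fderiv ℝ (g.localForm x) (extChartAt 𝓘(ℝ, E) x x))
      (h.localForm (F x) (extChartAt 𝓘(ℝ, E') (F x) (F x)))
      (fderiv ℝ (h.localForm (F x)) (extChartAt 𝓘(ℝ, E') (F x) (F x))) := by
  set a := extChartAt 𝓘(ℝ, E) x x
  set P := localRep (E := E) (E →L[ℝ] E →L[ℝ] ℝ)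
    (V := fun p : M ↦ TangentSpace 𝓘(ℝ, E) p →L[ℝ] TangentSpace 𝓘(ℝ, E) p →L[ℝ] ℝ)
    (pullbackForm F h.val) x
  set S := localRep (E := E) (E →L[ℝ] E →L[ℝ] ℝ)
    (V := fun p : M ↦ TangentSpace 𝓘(ℝ, E) p →L[ℝ] TangentSpace 𝓘(ℝ, E) p →L[ℝ] ℝ)
    (fun p ↦ Real.exp (τ p) • g.val p) x
  set T : E → ℝ := fun z ↦ τ ((extChartAt 𝓘(ℝ, E) x).symm z)
  set ψ := localMap (E := E) (E' := E') F x (F x)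
  have hψ : ContDiffAt ℝ 2 ψ a := (contDiffAt_localMap (hF.contMDiffAt hx)).of_le two_le_infty
  have hψa : ψ a = extChartAt 𝓘(ℝ, E') (F x) (F x) := localMap_self F x
  have hG : DifferentiableAt ℝ (g.localForm x) a :=
    (contDiffAt_localForm g x).differentiableAt (by simp)
  have hH : DifferentiableAt ℝ (h.localForm (F x)) (ψ a) := by
    rw [hψa]
    exact (contDiffAt_localForm h (F x)).differentiableAt (by simp)
  have hT : DifferentiableAt ℝ T a :=
    (contDiffAt_comp_extChartAt_symm hτ).differentiableAt (by simp)
  have hPev : ∀ᶠ z in 𝓝 a, ∀ u w,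
      P z u w = h.localForm (F x) (ψ z) (fderiv ℝ ψ z u) (fderiv ℝ ψ z w) :=
    hF.localRep_pullbackForm h hx
  -- Differentiability as a map into bilinear forms must be known before the derivative can be found
  -- by evaluating on vectors.
  have hP : DifferentiableAt ℝ P a := by
    have h1 : DifferentiableAt ℝ (fun z ↦ h.localForm (F x) (ψ z)) a :=
      (hasFDerivAt_fderiv_comp (F := E' →L[ℝ] E' →L[ℝ] ℝ) (h.localForm (F x)) hH (hψ.differentiableAt (by simp))).differentiableAt
    refine (differentiableAt_bilinearComp h1
      (hasFDerivAt_fderiv hψ).differentiableAt).congr_of_eventuallyEq ?_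
    filter_upwards [hPev] with z hz
    ext u w
    exact hz u w
  have hS : S =ᶠ[𝓝 a] fun z ↦ Real.exp (T z) • g.localForm x z := by
    filter_upwards [extChartAt_target_mem_nhds_self x] with z hz
    ext u w
    rw [smul_apply, smul_apply, PseudoRiemannianMetric.localForm, localRep_bilinearForm _ x hz,
      localRep_bilinearForm _ x hz]
    rfl
  have hTa : T a = τ x := congrArg τ (extChartAt_to_inv x)
  have hP0 := hPev.self_of_nhds
  have hP1 := pullback_one_jet hψ hH hP hPev
  have hS0 (u w : E) : S a u w = Real.exp (τ x) * g.localForm x a u w := by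
    rw [hS.self_of_nhds, ← hTa]
    rfl
  have hS1 (z u w : E) : fderiv ℝ S a z u w
      = Real.exp (τ x) * (fderiv ℝ (g.localForm x) a z u w
        + fderiv ℝ T a z * g.localForm x a u w) := by
    rw [hS.fderiv_eq, ← hTa]
    exact congrArg (fun B : E →L[ℝ] E →L[ℝ] ℝ ↦ B u w)
      (fderiv_exp_smul (F := E →L[ℝ] E →L[ℝ] ℝ) (G := g.localForm x) hG hT z)
  rw [hψa] at hP0 hP1
  rw [SameJet, iteratedFDeriv_le_one_eq_iff]
  constructor
  · rintro ⟨e0, e1⟩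
    refine ⟨fun u w ↦ ?_, fun z u w ↦ ?_⟩
    · rw [← hP0, ← hS0]
      exact congrArg (fun B : E →L[ℝ] E →L[ℝ] ℝ ↦ B u w) e0
    · rw [← hP1, ← hS1]
      exact congrArg (fun B : E →L[ℝ] E →L[ℝ] E →L[ℝ] ℝ ↦ B z u w) e1
  · rintro ⟨e0, e1⟩
    constructor
    · ext u w
      exact (hP0 u w).trans ((e0 u w).trans (hS0 u w).symm)
    · ext z u w
      exact (hP1 z u w).trans ((e1 z u w).trans (hS1 z u w).symm)

end IsSmoothDiffeo

end JetsOfLocalDiffeomorphism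

/-! ### Realizing a prescribed 2-jet by a local diffeomorphism. -/

section Realization

open Filter Topology

variable {E : Type*} [NormedAddCommGroup E] [NormedSpace ℝ E]
  {E' : Type*} [NormedAddCommGroup E'] [NormedSpace ℝ E']

/-- The quadratic map with prescribed `2`-jet at `a`. -/
def quadraticMap (a : E) (b : E') (L : E →L[ℝ] E') (R : E →L[ℝ] E →L[ℝ] E') (z : E) : E' :=
  b + L (z - a) + (1 / 2 : ℝ) • R (z - a) (z - a)

variable (a : E) (b : E') (L : E →L[ℝ] E') {R : E →L[ℝ] E →L[ℝ] E'}

lemma quadraticMap_self : quadraticMap a b L R a = b := by simp [quadraticMap]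

lemma contDiff_quadraticMap : ContDiff ℝ ∞ (quadraticMap a b L R) := by
  unfold quadraticMap
  fun_prop

/-- By symmetry of `R` both slots contribute equally, which cancels the `1 / 2`. The formula holds
at every `z`, so it can be differentiated again. -/
lemma hasFDerivAt_quadraticMap (hR : ∀ z u, R z u = R u z) (z : E) :
    HasFDerivAt (quadraticMap a b L R) (L + R (z - a)) z := by
  have h : HasFDerivAt (fun z ↦ z - a) (ContinuousLinearMap.id ℝ E) z :=
    (hasFDerivAt_id z).sub_const a
  have := ((L.hasFDerivAt.comp z h).const_add b).add
    (((R.hasFDerivAt.comp z h).clm_apply h).const_smul (1 / 2 : ℝ))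
  refine (this.congr_of_eventuallyEq (Eventually.of_forall fun z ↦ rfl)).congr_fderiv ?_
  ext u
  simp only [Function.comp_apply, ContinuousLinearMap.comp_id, add_apply, smul_apply,
    ContinuousLinearMap.flip_apply, hR u]
  rw [← two_smul ℝ, smul_smul]
  norm_num

lemma fderiv_quadraticMap (hR : ∀ z u, R z u = R u z) :
    fderiv ℝ (quadraticMap a b L R) a = L := by
  simpa using (hasFDerivAt_quadraticMap a b L hR a).fderiv

lemma fderiv_fderiv_quadraticMap (hR : ∀ z u, R z u = R u z) :
    fderiv ℝ (fderiv ℝ (quadraticMap a b L R)) a = R := by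
  have h : fderiv ℝ (quadraticMap a b L R) = fun z ↦ L + R (z - a) :=
    funext fun z ↦ (hasFDerivAt_quadraticMap a b L hR z).fderiv
  rw [h]
  exact ((R.hasFDerivAt.comp a ((hasFDerivAt_id a).sub_const a)).const_add L).fderiv

lemma exists_openPartialHomeomorph_of_contDiff [CompleteSpace E] {f : E → E'}
    (hf : ContDiff ℝ ∞ f) (L : E ≃L[ℝ] E') (hL : fderiv ℝ f a = L) :
    ∃ Φ : OpenPartialHomeomorph E E', a ∈ Φ.source ∧ (∀ z, Φ z = f z) ∧
      ContDiffOn ℝ ∞ Φ.symm Φ.target := by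
  have hd : HasFDerivAt f (L : E →L[ℝ] E') a := by
    rw [← hL]; exact (hf.differentiable (by simp) a).hasFDerivAt
  let Φ := hf.contDiffAt.toOpenPartialHomeomorph f hd (by simp)
  have ha : a ∈ Φ.source := hf.contDiffAt.mem_toOpenPartialHomeomorph_source hd (by simp)
  -- Restricting to the open set where the derivative is invertible makes the inverse smooth on the
  -- whole target, not only near `f a`.
  have hs : IsOpen {z | fderiv ℝ f z ∈ Set.range ((↑) : (E ≃L[ℝ] E') → E →L[ℝ] E')} :=
    (ContinuousLinearEquiv.isOpen (𝕜 := ℝ) (E := E) (F := E')).preimage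
      (hf.continuous_fderiv (by simp))
  refine ⟨Φ.restrOpen _ hs, ⟨ha, L, hL.symm⟩, fun z ↦ rfl, fun z hz ↦ ?_⟩
  obtain ⟨-, L', hL'⟩ := (Φ.restrOpen _ hs).map_target hz
  refine (OpenPartialHomeomorph.contDiffAt_symm (Φ.restrOpen _ hs) (f₀' := L') hz ?_
    hf.contDiffAt).contDiffWithinAt
  rw [hL']
  exact (hf.differentiable (by simp) _).hasFDerivAt

variable {M : Type*} [TopologicalSpace M] [ChartedSpace E M] [IsManifold 𝓘(ℝ, E) ∞ M]
  {N : Type*} [TopologicalSpace N] [ChartedSpace E' N] [IsManifold 𝓘(ℝ, E') ∞ N]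

omit a b L in
/-- Every `2`-jet with invertible linear part is the jet of a local diffeomorphism. -/
lemma exists_isSmoothDiffeo [CompleteSpace E] (x : M) (y : N) (L : E ≃L[ℝ] E')
    (hR : ∀ z u, R z u = R u z) :
    ∃ F : OpenPartialHomeomorph M N, IsSmoothDiffeo (E := E) (E' := E') F ∧
      x ∈ F.source ∧ F.source ⊆ (chartAt E x).source ∧ F x = y ∧
      fderiv ℝ (localMap (E := E) (E' := E') F x y) (extChartAt 𝓘(ℝ, E) x x) = L ∧
      fderiv ℝ (fderiv ℝ (localMap (E := E) (E' := E') F x y)) (extChartAt 𝓘(ℝ, E) x x) = R := by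
  set a : E := extChartAt 𝓘(ℝ, E) x x with ha
  set b : E' := extChartAt 𝓘(ℝ, E') y y with hb
  obtain ⟨Φ, haΦ, hΦ, hΦs⟩ := exists_openPartialHomeomorph_of_contDiff a
    (contDiff_quadraticMap a b L (R := R)) L (fderiv_quadraticMap a b L hR)
  have hΦa : Φ a = b := by rw [hΦ, quadraticMap_self]
  have hΦd : ContDiff ℝ ∞ Φ := by
    rw [show (Φ : E → E') = quadraticMap a b L R from funext hΦ]
    exact contDiff_quadraticMap a b L
  let F : OpenPartialHomeomorph M N := (chartAt E x).trans (Φ.trans (chartAt E' y).symm)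
  have hF (p : M) : F p = (chartAt E' y).symm (Φ (chartAt E x p)) := rfl
  have hFs (q : N) : F.symm q = (chartAt E x).symm (Φ.symm (chartAt E' y q)) := rfl
  have hsrc {p : M} : p ∈ F.source ↔ p ∈ (chartAt E x).source ∧ chartAt E x p ∈ Φ.source ∧
      Φ (chartAt E x p) ∈ (chartAt E' y).target := by
    simp [F]
  have htgt {q : N} (hq : q ∈ F.target) : q ∈ (chartAt E' y).source ∧ chartAt E' y q ∈ Φ.target ∧
      Φ.symm (chartAt E' y q) ∈ (chartAt E x).target := by
    simpa [F, OpenPartialHomeomorph.trans_target, and_assoc] using hq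
  have hbt : b ∈ (chartAt E' y).target := mem_chart_target E' y
  have hloc : localMap (E := E) (E' := E') F x y =ᶠ[𝓝 a] quadraticMap a b L R := by
    have hc : ∀ᶠ z in 𝓝 a, Φ z ∈ (chartAt E' y).target :=
      hΦd.continuous.continuousAt.eventually
        ((chartAt E' y).open_target.mem_nhds (by rw [hΦa]; exact hbt))
    filter_upwards [hc, (chartAt E x).open_target.mem_nhds (mem_chart_target E x)] with z h1 h2
    have h3 : localMap (E := E) (E' := E') F x y z
        = chartAt E' y ((chartAt E' y).symm (Φ (chartAt E x ((chartAt E x).symm z)))) := rfl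
    rw [h3, (chartAt E x).right_inv h2, (chartAt E' y).right_inv h1, hΦ]
  refine ⟨F, ⟨?_, ?_⟩, ?_, fun p hp ↦ (hsrc.1 hp).1, ?_, ?_, ?_⟩
  · have h1 : ContMDiffOn 𝓘(ℝ, E) 𝓘(ℝ, E') ∞ (Φ ∘ chartAt E x) F.source :=
      hΦd.contMDiff.comp_contMDiffOn (contMDiffOn_chart.mono fun p hp ↦ (hsrc.1 hp).1)
    exact contMDiffOn_chart_symm.comp h1 fun p hp ↦ (hsrc.1 hp).2.2
  · have h1 : ContMDiffOn 𝓘(ℝ, E') 𝓘(ℝ, E) ∞ (Φ.symm ∘ chartAt E' y) F.target :=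
      hΦs.contMDiffOn.comp (contMDiffOn_chart.mono fun q hq ↦ (htgt hq).1)
        fun q hq ↦ (htgt hq).2.1
    exact contMDiffOn_chart_symm.comp h1 fun q hq ↦ (htgt hq).2.2
  · refine hsrc.2 ⟨mem_chart_source E x, haΦ, ?_⟩
    rw [show chartAt E x x = a from rfl, hΦa]
    exact hbt
  · rw [hF, show chartAt E x x = a from rfl, hΦa]
    exact (chartAt E' y).left_inv (mem_chart_source E' y)
  · rw [hloc.fderiv_eq, fderiv_quadraticMap a b L hR]
  · rw [hloc.fderiv.fderiv_eq, fderiv_fderiv_quadraticMap a b L hR]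

end Realization

/-! ### Equivalence of 2-jets in coordinates, and change of sign of the metric. -/

section Main

open Filter Topology

variable {E : Type*} [NormedAddCommGroup E] [NormedSpace ℝ E] [FiniteDimensional ℝ E]
  {M : Type*} [TopologicalSpace M] [ChartedSpace E M] [IsManifold 𝓘(ℝ, E) ∞ M]
  {E' : Type*} [NormedAddCommGroup E'] [NormedSpace ℝ E'] [FiniteDimensional ℝ E']
  {N : Type*} [TopologicalSpace N] [ChartedSpace E' N] [IsManifold 𝓘(ℝ, E') ∞ N]

set_option synthInstance.maxHeartbeats 200000 in
/-- Conformal equivalence of `2`-jets in terms of derivatives in coordinates. -/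
lemma twoJetsConformallyEquivalent_iff {g : PseudoRiemannianMetric E M}
    (v : ConformalVectorField g) {x : M} (hx : v.toFun x = 0)
    {h : PseudoRiemannianMetric E' N} (w : ConformalVectorField h) {y : N} (hy : w.toFun y = 0)
    (h' : PseudoRiemannianMetric E' N) :
    TwoJetsConformallyEquivalent g v.toFun x h' w.toFun y ↔
      ∃ (L : E ≃L[ℝ] E') (R : E →L[ℝ] E →L[ℝ] E') (α : E →L[ℝ] ℝ), (∀ z u, R z u = R u z) ∧
        MapsVectorJet L R (v.jet hx).lin (v.jet hx).quad (w.jet hy).lin (w.jet hy).quad ∧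
        ∃ c ∈ Set.Ioi (0 : ℝ), PullsMetricJet L R c α (v.jet hx).form (v.jet hx).dform
          (h'.localForm y (extChartAt 𝓘(ℝ, E') y y))
          (fderiv ℝ (h'.localForm y) (extChartAt 𝓘(ℝ, E') y y)) := by
  constructor
  · rintro ⟨F, τ, hxF, rfl, hF1, hF2, hτ, hj2, hj1⟩
    have hF : IsSmoothDiffeo (E := E) (E' := E') F := ⟨hF1, hF2⟩
    obtain ⟨L, hL⟩ := hF.exists_equiv_fderiv_localMap hxF
    have h2 := (hF.sameJet_two_iff hxF (v.contDiffAt_localField x) (v.localField_eq_zero hx)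
      (w.localField_eq_zero hy)).1 hj2
    have h1 := (hF.sameJet_one_iff hxF g h'
      (hτ.contMDiffAt (F.open_source.mem_nhds hxF))).1 hj1
    rw [← hL] at h1 h2
    exact ⟨L, _, _, (((contDiffAt_localMap (hF.contMDiffAt hxF)).of_le
      two_le_infty).isSymmSndFDerivAt (by simp)), h2, _, Real.exp_pos _, h1⟩
  · rintro ⟨L, R, α, hR, h2, c, hc, h1⟩
    have : CompleteSpace E := FiniteDimensional.complete ℝ E
    obtain ⟨F, hF, hxF, hFs, rfl, e1, e2⟩ := exists_isSmoothDiffeo x y L hR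
    set a := extChartAt 𝓘(ℝ, E) x x with ha
    -- Affine, with value `log c` and derivative `α` at `a`, so that `exp T` has 1-jet `(c, c α)`.
    let T : E → ℝ := fun z ↦ Real.log c + α (z - a)
    let τ : M → ℝ := fun p ↦ T (chartAt E x p)
    have hT : ContDiff ℝ ∞ T := by fun_prop
    have hτ : ContMDiffOn 𝓘(ℝ, E) 𝓘(ℝ, ℝ) ∞ τ F.source :=
      hT.contMDiff.comp_contMDiffOn (contMDiffOn_chart.mono hFs)
    have hτx : Real.exp (τ x) = c := by
      have : τ x = Real.log c + α (a - a) := rfl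
      rw [this, sub_self, map_zero, add_zero, Real.exp_log hc]
    have hdτ : fderiv ℝ (fun z ↦ τ ((extChartAt 𝓘(ℝ, E) x).symm z)) a = α := by
      have : (fun z ↦ τ ((extChartAt 𝓘(ℝ, E) x).symm z)) =ᶠ[𝓝 a] T := by
        filter_upwards [extChartAt_target_mem_nhds_self x] with z hz
        exact congrArg T ((extChartAt 𝓘(ℝ, E) x).right_inv hz)
      rw [this.fderiv_eq]
      exact ((α.hasFDerivAt.comp a ((hasFDerivAt_id a).sub_const a)).const_add _).fderiv
    refine ⟨F, τ, hxF, rfl, hF.contMDiffOn, hF.contMDiffOn_symm, hτ,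
      (hF.sameJet_two_iff hxF (v.contDiffAt_localField x) (v.localField_eq_zero hx)
        (w.localField_eq_zero hy)).2 ?_,
      (hF.sameJet_one_iff hxF g h'
        (hτ.contMDiffAt (F.open_source.mem_nhds hxF))).2 ?_⟩
    · rw [e1, e2]
      exact h2
    · rw [e1, e2, hτx, hdτ]
      exact h1

set_option synthInstance.maxHeartbeats 200000 in
omit [FiniteDimensional ℝ E'] in
lemma localForm_neg (h : PseudoRiemannianMetric E' N) (y : N) {z : E'}
    (hz : z ∈ (extChartAt 𝓘(ℝ, E') y).target) : h.neg.localForm y z = -h.localForm y z := by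
  ext u w
  exact (localRep_bilinearForm h.neg.val y hz u w).trans
    (congrArg Neg.neg (localRep_bilinearForm h.val y hz u w)).symm

omit [FiniteDimensional ℝ E] in
lemma fderiv_apply_of_eventuallyEq_neg {W : Type*} [NormedAddCommGroup W] [NormedSpace ℝ W]
    {f f' : E → W} {a : E} (hf : f' =ᶠ[𝓝 a] fun z ↦ -f z) (z : E) :
    fderiv ℝ f' a z = -fderiv ℝ f a z := by
  rw [hf.fderiv_eq, fderiv_fun_neg, neg_apply]

set_option synthInstance.maxHeartbeats 200000 in
omit [FiniteDimensional ℝ E'] in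
lemma fderiv_localForm_neg (h : PseudoRiemannianMetric E' N) (y : N) (z : E') :
    fderiv ℝ (h.neg.localForm y) (extChartAt 𝓘(ℝ, E') y y) z
      = -fderiv ℝ (h.localForm y) (extChartAt 𝓘(ℝ, E') y y) z := by
  refine fderiv_apply_of_eventuallyEq_neg (W := E' →L[ℝ] E' →L[ℝ] ℝ) ?_ z
  filter_upwards [extChartAt_target_mem_nhds_self y] with z hz
  exact localForm_neg h y hz

-- The sign of the target metric moves into `c`; `α` is unchanged because the function jet is
-- written `(c, c α)`.
omit [FiniteDimensional ℝ E] [FiniteDimensional ℝ E'] in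
lemma PullsMetricJet.neg {L : E →L[ℝ] E'} {R : E →L[ℝ] E →L[ℝ] E'} {c : ℝ} {α : E →L[ℝ] ℝ}
    {G₀ : E →L[ℝ] E →L[ℝ] ℝ} {G₁ : E →L[ℝ] E →L[ℝ] E →L[ℝ] ℝ} {H₀ H₀' : E' →L[ℝ] E' →L[ℝ] ℝ}
    {H₁ H₁' : E' →L[ℝ] E' →L[ℝ] E' →L[ℝ] ℝ} (hH : PullsMetricJet L R c α G₀ G₁ H₀ H₁)
    (h₀ : ∀ u w, H₀' u w = -H₀ u w) (h₁ : ∀ z u w, H₁' z u w = -H₁ z u w) :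
    PullsMetricJet L R (-c) α G₀ G₁ H₀' H₁' where
  form u w := by linarith [hH.form u w, h₀ (L u) (L w)]
  dform z u w := by
    linarith [hH.dform z u w, h₀ (R z u) (L w), h₀ (L u) (R z w), h₁ (L z) (L u) (L w)]

set_option synthInstance.maxHeartbeats 200000 in
omit [FiniteDimensional ℝ E] [FiniteDimensional ℝ E'] in
lemma pullsMetricJet_neg_iff {L : E →L[ℝ] E'} {R : E →L[ℝ] E →L[ℝ] E'} {c : ℝ} {α : E →L[ℝ] ℝ}
    {G₀ : E →L[ℝ] E →L[ℝ] ℝ} {G₁ : E →L[ℝ] E →L[ℝ] E →L[ℝ] ℝ} (h : PseudoRiemannianMetric E' N)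
    (y : N) :
    PullsMetricJet L R c α G₀ G₁ (h.neg.localForm y (extChartAt 𝓘(ℝ, E') y y))
        (fderiv ℝ (h.neg.localForm y) (extChartAt 𝓘(ℝ, E') y y)) ↔
      PullsMetricJet L R (-c) α G₀ G₁ (h.localForm y (extChartAt 𝓘(ℝ, E') y y))
        (fderiv ℝ (h.localForm y) (extChartAt 𝓘(ℝ, E') y y)) := by
  have h₀ (u w : E') : h.neg.localForm y (extChartAt 𝓘(ℝ, E') y y) u w
      = -h.localForm y (extChartAt 𝓘(ℝ, E') y y) u w := by
    rw [localForm_neg h y (mem_extChartAt_target y)]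
    rfl
  have h₁ (z u w : E') : fderiv ℝ (h.neg.localForm y) (extChartAt 𝓘(ℝ, E') y y) z u w
      = -fderiv ℝ (h.localForm y) (extChartAt 𝓘(ℝ, E') y y) z u w := by
    rw [fderiv_localForm_neg]
    rfl
  refine ⟨fun hH ↦ hH.neg (fun u w ↦ ?_) fun z u w ↦ ?_, fun hH ↦ ?_⟩
  · rw [h₀, neg_neg]
  · rw [h₁, neg_neg]
  · simpa only [neg_neg] using hH.neg h₀ h₁

end Main

end ConformalJets

end


theorem lemma8p1
    {E : Type*} [NormedAddCommGroup E] [NormedSpace ℝ E] [FiniteDimensional ℝ E]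
    {M : Type*} [TopologicalSpace M] [ChartedSpace E M] [IsManifold 𝓘(ℝ, E) ∞ M]
    {E' : Type*} [NormedAddCommGroup E'] [NormedSpace ℝ E'] [FiniteDimensional ℝ E']
    {N : Type*} [TopologicalSpace N] [ChartedSpace E' N] [IsManifold 𝓘(ℝ, E') ∞ N]
    (hM : 2 ≤ Module.finrank ℝ E) (hN : 2 ≤ Module.finrank ℝ E')
    (g : ConformalJets.PseudoRiemannianMetric E M) (v : ConformalJets.ConformalVectorField g)
    (x : M) (hx : v.toFun x = 0)
    (h : ConformalJets.PseudoRiemannianMetric E' N) (w : ConformalJets.ConformalVectorField h)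
    (y : N) (hy : w.toFun y = 0) :
    (ConformalJets.TwoJetsConformallyEquivalent g v.toFun x h w.toFun y ↔
      (v.quintuple x).AlgebraicallyEquivalent (Set.Ioi 0) (w.quintuple y)) ∧
    ((ConformalJets.TwoJetsConformallyEquivalent g v.toFun x h w.toFun y ∨
        ConformalJets.TwoJetsConformallyEquivalent g v.toFun x h.neg w.toFun y) ↔
      (v.quintuple x).AlgebraicallyEquivalent {0}ᶜ (w.quintuple y)) := by
  have : Nontrivial E := Module.nontrivial_of_finrank_pos (R := ℝ) (by omega)
  constructor
  · rw [ConformalJets.quintuple_algebraicallyEquivalent_iff hx hy (C := Set.Ioi 0) (by simp)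
        (by simp) (fun a ha b hb ↦ mul_pos (Set.mem_Ioi.1 ha) (Set.mem_Ioi.1 hb))
        (fun a ha ↦ inv_pos.2 (Set.mem_Ioi.1 ha)),
      ← ConformalJets.ConformalJet.exists_mapsJet_iff _ _ (by simp)]
    exact ConformalJets.twoJetsConformallyEquivalent_iff v hx w hy h
  -- Only the compared metric becomes `h.neg`; the jet of `w` is still taken with respect to `h`,
  -- for which `w` is given as conformal.
  · rw [ConformalJets.quintuple_algebraicallyEquivalent_iff hx hy (C := {0}ᶜ) (by simp)
        (by simp) (fun a ha b hb ↦ by simp_all) (fun a ha ↦ by simp_all),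
      ← ConformalJets.ConformalJet.exists_mapsJet_iff _ _ (by simp),
      ConformalJets.twoJetsConformallyEquivalent_iff v hx w hy h,
      ConformalJets.twoJetsConformallyEquivalent_iff v hx w hy h.neg]
    constructor
    · rintro (⟨L, R, α, hR, h2, c, hc, h1⟩ | ⟨L, R, α, hR, h2, c, hc, h1⟩)
      · exact ⟨L, R, α, hR, h2, c, (Set.mem_Ioi.1 hc).ne', h1⟩
      · exact ⟨L, R, α, hR, h2, -c, neg_ne_zero.2 (Set.mem_Ioi.1 hc).ne',
          (ConformalJets.pullsMetricJet_neg_iff h y).1 h1⟩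
    · rintro ⟨L, R, α, hR, h2, c, hc, h1⟩
      -- A negative factor for `h` is a positive factor for `h.neg`.
      rcases lt_or_gt_of_ne (show c ≠ 0 from hc) with hc | hc
      · exact .inr ⟨L, R, α, hR, h2, -c, neg_pos.2 hc,
          (ConformalJets.pullsMetricJet_neg_iff h y).2 (by rw [neg_neg]; exact h1)⟩
      · exact .inl ⟨L, R, α, hR, h2, c, hc, h1⟩
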